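/- Fix constants $M>0$, $K,L\in\mathbb{N}$ and two probability distributions $D,D'$ on $\mathbb{R}$ (for instance on $\mathbb{R}_+$). There are $n$ students and $Mn$ universities (rounded down to an integer), and every university can accept at most $L$ students. The students' preference lists are independent, uniformly random orderings of all universities. Given these lists, every university $u$ observes for every student $s$ an independent signal, drawn from $D$ if $u$ is the favorite university of $s$ and from $D'$ otherwise, and ranks the students in decreasing order of signal, with ties broken uniformly at random. Consider student-proposing deferred acceptance (which yields the student-optimal stable matching) in which each student proposes to at most her $K$ favorite universities. Let $y_i\cdot n$ be the expected number of students who propose to their $i$-th favorite university, for $1\le i\le K$, let $y_0=1$ and $\vec y=(y_1,\dots,y_K)$; these numbers depend on $n$. For $\vec x\in[0,\infty)^K$ and $1\le i\le K$, let $f_i(\vec x)\cdot n=f_i^{D,D',M,L}(\vec x)\cdot n$ be the expected number of proposals of type $i$ that are accepted when, for every $j\in\{1,\dots,K\}$, exactly $x_jn$ (rounded down) proposals of type $j$ are made, each to an independent uniformly random one of the $Mn$ universities, every proposal gets an independent signal, drawn from $D$ if its type is $1$ and from $D'$ otherwise, and every university accepts the $L$ proposals with the highest signals among those it received (all of them if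 there are fewer than $L$), with ties broken uniformly at random. Let $f_0=0$. Then for every $i\in\{1,\dots,K\}$, $$ y_i = y_{i-1}-f_{i-1}(\vec y)\pm o(1)\qquad (n\to\infty). $$ -/

import Mathlib

open MeasureTheory Filter Topology

noncomputable section

namespace SignalMatching

/-- What a university observes about an application: a real-valued signal, together with a
uniform label in `[0, 1]` that is used only to break ties between equal signals at random
(it matters only when a signal distribution has atoms). Scores are compared lexicographically. -/
abbrev Score : Type := ℝ × unitInterval

/-- `Beats a b`: the score `a` is ranked above the score `b`. -/
def Beats (a b : Score) : Prop := toLex b < toLex a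

/-- A score whose signal is drawn from `D` and whose tie-breaking label is independent
and uniform. -/
def scoreLaw (D : Measure ℝ) : Measure Score := D.prod volume

/-- The number of universities when there are `n` students and the ratio is `M`. -/
def numUniv (M : ℝ) (n : ℕ) : ℕ := ⌊M * n⌋₊

/-! ### Student-proposing deferred acceptance -/

/-- Strict preference orders of `n` students over `N` universities: `π s k` is the university
in position `k` (counted from `0`) of the list of student `s`. -/
abbrev Prefs (n N : ℕ) : Type := Fin n → Equiv.Perm (Fin N)

/-- Given the students' lists, the scores that the universities give to the students are
independent; the signal comes from `D` if the university is the student's favorite,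
and from `D'` otherwise. -/
def signalLaw (D D' : Measure ℝ) {n N : ℕ} (π : Prefs n N) :
    Measure (Fin n × Fin N → Score) :=
  Measure.pi fun p => if ((π p.1).symm p.2 : ℕ) = 0 then scoreLaw D else scoreLaw D'

/-- The university to which student `s` currently proposes (or which currently holds her
proposal), when `r s` is the number of rejections she has received so far;
`none` if she has exhausted the `K` applications that she is willing to make. -/
def target (K : ℕ) {n N : ℕ} (π : Prefs n N) (r : Fin n → ℕ) (s : Fin n) : Option (Fin N) :=
  if h : r s < N ∧ r s < K then some (π s ⟨r s, h.1⟩) else none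

/-- Student `s` is rejected in the current round: the university `u` to which she proposes
has at least `L` current proposals with higher scores. -/
def Rejected (K L : ℕ) {n N : ℕ} (π : Prefs n N) (σ : Fin n × Fin N → Score)
    (r : Fin n → ℕ) (s : Fin n) : Prop :=
  ∃ u, target K π r s = some u ∧
    L ≤ {s' : Fin n | target K π r s' = some u ∧ Beats (σ (s', u)) (σ (s, u))}.ncard

open Classical in
/-- One round of deferred acceptance: every university keeps the `L` best of its current
proposals and rejects the others; rejected students move on to their next university. -/
def daStep (K L : ℕ) {n N : ℕ} (π : Prefs n N) (σ : Fin n × Fin N → Score)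
    (r : Fin n → ℕ) : Fin n → ℕ :=
  fun s => if Rejected K L π σ r s then r s + 1 else r s

/-- The number of rejections that each student has received at the end of deferred acceptance.
Every round before termination contains a rejection, and each student is rejected at most
`K` times, so that `n * K` rounds suffice. -/
def daRejections (K L : ℕ) {n N : ℕ} (π : Prefs n N) (σ : Fin n × Fin N → Score) :
    Fin n → ℕ :=
  (daStep K L π σ)^[n * K] (fun _ => 0)

/-- The number of students who propose to their `i`-th favorite university (`i ≥ 1`):
those who have been rejected by their `i - 1` favorite ones. -/
def proposerCount (K L : ℕ) {n N : ℕ} (π : Prefs n N) (σ : Fin n × Fin N → Score)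
    (i : ℕ) : ℕ :=
  {s : Fin n | i ≤ K ∧ i ≤ N ∧ i ≤ daRejections K L π σ s + 1}.ncard

/-- The expected number of students who propose to their `i`-th favorite university, when the
students' lists are independent and uniformly random. -/
def expectedProposers (D D' : Measure ℝ) (K L n N i : ℕ) : ℝ :=
  (∑ π : Prefs n N, ∫ σ, (proposerCount K L π σ i : ℝ) ∂(signalLaw D D' π)) /
    Fintype.card (Prefs n N)

/-- `y D D' M K L n i * n` is the expected number of students who propose to their `i`-th
favorite university, for `i ≥ 1`; by convention the value at `i = 0` is `1`. -/
def y (D D' : Measure ℝ) (M : ℝ) (K L n : ℕ) : ℕ → ℝ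
  | 0 => 1
  | i + 1 => expectedProposers D D' K L n (numUniv M n) (i + 1) / n

/-! ### Independent random proposals -/

/-- The set of proposals when `x j * n` (rounded down) proposals of type `j` are made for
`1 ≤ j ≤ K`. The first component is the type minus one. -/
abbrev Proposal (K n : ℕ) (x : ℕ → ℝ) : Type :=
  Σ j : Fin K, Fin ⌊x ((j : ℕ) + 1) * n⌋₊

/-- The type, in `{1, …, K}`, of a proposal. -/
def Proposal.type {K n : ℕ} {x : ℕ → ℝ} (p : Proposal K n x) : ℕ := (p.1 : ℕ) + 1

/-- The scores of the proposals are independent, with signals drawn from `D` for proposals of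
type `1` and from `D'` for all others. -/
def proposalLaw (D D' : Measure ℝ) (K n : ℕ) (x : ℕ → ℝ) :
    Measure (Proposal K n x → Score) :=
  Measure.pi fun p => if Proposal.type p = 1 then scoreLaw D else scoreLaw D'

/-- The number of proposals of type `i` that are accepted, when the proposal `p` goes to the
university `g p` with score `τ p`, and every university accepts its `L` best proposals. -/
def acceptedCount (L : ℕ) {K n N : ℕ} {x : ℕ → ℝ} (g : Proposal K n x → Fin N)
    (τ : Proposal K n x → Score) (i : ℕ) : ℕ :=
  {p : Proposal K n x | Proposal.type p = i ∧
    {q : Proposal K n x | g q = g p ∧ Beats (τ q) (τ p)}.ncard < L}.ncard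

/-- The expected number of accepted proposals of type `i`, when every proposal goes to an
independent uniformly random university among `N`. -/
def expectedAccepted (D D' : Measure ℝ) (K L n N : ℕ) (x : ℕ → ℝ) (i : ℕ) : ℝ :=
  (∑ g : Proposal K n x → Fin N,
      ∫ τ, (acceptedCount L g τ i : ℝ) ∂(proposalLaw D D' K n x)) /
    Fintype.card (Proposal K n x → Fin N)

/-- `f D D' M K L n i x * n` is the expected number of accepted proposals of type `i`, when
`x j * n` proposals of type `j` are made for `1 ≤ j ≤ K` to uniformly random universities.
As there are no proposals of type `0`, it vanishes for `i = 0`. -/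
def f (D D' : Measure ℝ) (M : ℝ) (K L n i : ℕ) (x : ℕ → ℝ) : ℝ :=
  expectedAccepted D D' K L n (numUniv M n) x i / n

end SignalMatching

end

/-! Write N for the number of universities. Replace the lists by independent uniform choices: a
sample gives each of the nK potential proposals a university, possibly repeated, and a score. The
first K entries of true lists have density at most (N/(N-K))^(nK) with respect to such choices,
which stays bounded as n grows. Hence an L¹ bound for samples carries over to the lists at the cost
of a constant (`average_prefs_le`).

Deferred acceptance ends with every university holding the best L of all proposals ever made to it
(`accepted_made`). So if a_j students make a proposal of type j (counted from 0), then a_{j+1} is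
a_j minus the number of accepted proposals of type j. The set of proposals made depends on the
sample, but it is explored adaptively. If the proposals of each type are listed in the order in
which they are made, the explored set becomes "the first a_j of each type j". This reordering is
injective and is piecewise a type-preserving permutation of coordinates, so it does not increase the
probability of any event (`sampleLaw_reorder_preimage_le`). Any statement that holds with high
probability for all initial segments of a fresh sample thus applies to the explored set.

Such a uniform statement is concentration. Changing one proposal changes the number of accepted ones
of a given type by at most 2, so the variance is O(n). Chebyshev on a grid with m points per
coordinate, and a Lipschitz bound between grid points, give deviations O(n/m) for all segments at
once. With high probability, therefore, a_{j+1} = a_j - E_j(a) ± δ, where E_j(a) is the expected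
number of accepted proposals of type j and δ = O(n/m).

This system is implicit, as E_j(a) depends on every a_k, so its stability needs an argument
(`ApproxSolution.sub_le`). Each x_j - E_j(x) is monotone in x. The maximum z of two approximate
solutions a, b therefore satisfies E_j(z) ≤ z_j - z_{j+1} + δ. Summing over j, the total accepted at
z exceeds the total at a by at most 2Kδ. But each additional proposal reaches an empty university
with probability at least c > 0, so the total grows by at least c per proposal, and z is within
2Kδ/c of a. All approximate solutions are thus close to one deterministic a. The numbers of
proposers concentrate around it, their expectations are close to it, and the Lipschitz bound
transfers the recursion from a to the expectations. For fixed m let n tend to infinity; m is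
arbitrary. -/

noncomputable section

namespace SignalMatching

/-! ### Acceptance of proposals -/

section Acceptance

open Classical in
/-- The proposals in `S` that compete with `p` and are ranked above it. -/
def rivals {ι U : Type*} (g : ι → U) (B : ι → ι → Prop) (S : Finset ι) (p : ι) : Finset ι :=
  S.filter fun q => g q = g p ∧ B q p

open Classical in
/-- The proposals in `S` that are accepted when every university takes its `L` best ones. -/
def accepted {ι U : Type*} (L : ℕ) (g : ι → U) (B : ι → ι → Prop) (S : Finset ι) : Finset ι :=
  S.filter fun p => (rivals g B S p).card < L

variable {ι U : Type*} {L : ℕ} {g : ι → U} {B : ι → ι → Prop} {S S' : Finset ι} {p q : ι}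

lemma mem_rivals : q ∈ rivals g B S p ↔ q ∈ S ∧ g q = g p ∧ B q p := by
  simp [rivals]

lemma mem_accepted : p ∈ accepted L g B S ↔ p ∈ S ∧ (rivals g B S p).card < L := by
  simp [accepted]

lemma accepted_subset : accepted L g B S ⊆ S := Finset.filter_subset _ _

lemma rivals_mono (h : S ⊆ S') : rivals g B S p ⊆ rivals g B S' p := by
  intro q; simp only [mem_rivals]; exact fun hq => ⟨h hq.1, hq.2⟩

lemma mem_accepted_of_subset (h : S ⊆ S') (hp : p ∈ S) (hp' : p ∈ accepted L g B S') :
    p ∈ accepted L g B S :=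
  mem_accepted.2 ⟨hp, (Finset.card_le_card (rivals_mono h)).trans_lt (mem_accepted.1 hp').2⟩

open Classical in
/-- Accepted proposals of a given type. -/
def acceptedOf {ι U κ : Type*} (L : ℕ) (t : ι → κ) (g : ι → U) (B : ι → ι → Prop)
    (S : Finset ι) (j : κ) : Finset ι :=
  (accepted L g B S).filter fun p => t p = j

variable {κ : Type*} {t : ι → κ} {j : κ}

lemma mem_acceptedOf : p ∈ acceptedOf L t g B S j ↔ p ∈ accepted L g B S ∧ t p = j := by
  simp [acceptedOf]

lemma rivals_insert_card_le [DecidableEq ι] :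
    (rivals g B (insert p S) q).card ≤ (rivals g B S q).card + 1 := by
  refine (Finset.card_le_card (t := insert p (rivals g B S q)) ?_).trans (Finset.card_insert_le _ _)
  intro x; simp only [mem_rivals, Finset.mem_insert]; tauto

lemma rivals_insert_of_not [DecidableEq ι] (h : ¬ (g p = g q ∧ B p q)) :
    rivals g B (insert p S) q = rivals g B S q := by
  ext x; simp only [mem_rivals, Finset.mem_insert]
  constructor
  · rintro ⟨rfl | hx, h'⟩
    · exact absurd h' h
    · exact ⟨hx, h'⟩
  · rintro ⟨hx, h'⟩; exact ⟨Or.inr hx, h'⟩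

lemma accepted_insert_subset [DecidableEq ι] :
    accepted L g B (insert p S) ⊆ insert p (accepted L g B S) := by
  intro q hq
  rcases Finset.mem_insert.1 (accepted_subset hq) with rfl | h
  · exact Finset.mem_insert_self _ _
  · exact Finset.mem_insert_of_mem (mem_accepted_of_subset (Finset.subset_insert _ _) h hq)

/-- One new proposal adds at most one rival, so only a holder of the last place at the university of
`p` can be pushed out, and only by `p` itself. -/
lemma displaced [DecidableEq ι] (hq : q ∈ accepted L g B S \ accepted L g B (insert p S)) :
    q ∈ S ∧ g p = g q ∧ B p q ∧ (rivals g B S q).card < L ∧ L ≤ (rivals g B S q).card + 1 := by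
  obtain ⟨h1, h2⟩ := Finset.mem_sdiff.1 hq
  obtain ⟨h3, h4⟩ := mem_accepted.1 h1
  have h5 : L ≤ (rivals g B (insert p S) q).card := by
    by_contra h; exact h2 (mem_accepted.2 ⟨Finset.mem_insert_of_mem h3, by omega⟩)
  by_cases h : g p = g q ∧ B p q
  · exact ⟨h3, h.1, h.2, h4, h5.trans rivals_insert_card_le⟩
  · rw [rivals_insert_of_not h] at h5; omega

lemma rivals_card_lt [Std.Irrefl B] [IsTrans ι B] (hg : g p = g q) (hp : p ∈ S) (hB : B p q) :
    (rivals g B S p).card < (rivals g B S q).card := by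
  apply Finset.card_lt_card
  rw [Finset.ssubset_iff_of_subset]
  · exact ⟨p, mem_rivals.2 ⟨hp, hg, hB⟩, fun h => irrefl_of B p (mem_rivals.1 h).2.2⟩
  · intro x hx
    obtain ⟨a, b, c⟩ := mem_rivals.1 hx
    exact mem_rivals.2 ⟨a, b.trans hg, trans_of B c hB⟩

/-- Two displaced proposals would be at the same university with `L - 1` rivals each, whereas in a
total order the better one has strictly fewer rivals. This is where totality of the ranking matters.
-/
lemma displaced_card_le [DecidableEq ι] [IsStrictTotalOrder ι B] :
    (accepted L g B S \ accepted L g B (insert p S)).card ≤ 1 := by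
  rw [Finset.card_le_one]
  intro a ha b hb
  obtain ⟨a1, a2, a3, a4, a5⟩ := displaced ha
  obtain ⟨b1, b2, b3, b4, b5⟩ := displaced hb
  rcases trichotomous_of B a b with h | h | h
  · have := rivals_card_lt (S := S) (a2.symm.trans b2) a1 h; omega
  · exact h
  · have := rivals_card_lt (S := S) (b2.symm.trans a2) b1 h; omega

lemma mem_accepted_insert_of_displaced [DecidableEq ι] [IsStrictTotalOrder ι B]
    (hq : q ∈ accepted L g B S \ accepted L g B (insert p S)) :
    p ∈ accepted L g B (insert p S) := by
  obtain ⟨a1, a2, a3, a4, a5⟩ := displaced hq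
  refine mem_accepted.2 ⟨Finset.mem_insert_self _ _, ?_⟩
  rw [rivals_insert_of_not fun h => irrefl_of B p h.2]
  refine (Finset.card_le_card ?_).trans_lt a4
  intro x hx
  obtain ⟨a, b, c⟩ := mem_rivals.1 hx
  exact mem_rivals.2 ⟨a, b.trans a2, trans_of B c a3⟩

/-- If something is displaced, it is a single proposal, and `p` takes its place. -/
lemma card_accepted_le_insert [DecidableEq ι] [IsStrictTotalOrder ι B] (hp : p ∉ S) :
    (accepted L g B S).card ≤ (accepted L g B (insert p S)).card := by
  rcases Finset.eq_empty_or_nonempty (accepted L g B S \ accepted L g B (insert p S)) with h | h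
  · exact Finset.card_le_card (Finset.sdiff_eq_empty_iff_subset.1 h)
  · obtain ⟨q, hq⟩ := h
    have h1 := mem_accepted_insert_of_displaced hq
    have h2 : p ∈ accepted L g B (insert p S) \ accepted L g B S :=
      Finset.mem_sdiff.2 ⟨h1, fun h => hp (accepted_subset h)⟩
    have h3 := Finset.card_pos.2 ⟨p, h2⟩
    have h4 := displaced_card_le (L := L) (g := g) (B := B) (S := S) (p := p)
    have h5 := Finset.card_sdiff_add_card_inter (accepted L g B S) (accepted L g B (insert p S))
    have h6 := Finset.card_sdiff_add_card_inter (accepted L g B (insert p S)) (accepted L g B S)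
    rw [Finset.inter_comm] at h6
    omega

lemma accepted_insert_of_vacant [DecidableEq ι] [Std.Irrefl B] (hL : 0 < L)
    (h : ∀ q ∈ S, g q ≠ g p) : accepted L g B (insert p S) = insert p (accepted L g B S) := by
  refine accepted_insert_subset.antisymm ?_
  intro q hq
  rcases Finset.mem_insert.1 hq with rfl | hq
  · refine mem_accepted.2 ⟨Finset.mem_insert_self _ _, ?_⟩
    have : rivals g B (insert q S) q = ∅ := by
      ext x; simp only [mem_rivals, Finset.mem_insert, Finset.notMem_empty, iff_false]
      rintro ⟨rfl | h1, h2, h3⟩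
      · exact irrefl_of B _ h3
      · exact h x h1 h2
    simpa [this] using hL
  · obtain ⟨h1, h2⟩ := mem_accepted.1 hq
    refine mem_accepted.2 ⟨Finset.mem_insert_of_mem h1, ?_⟩
    rwa [rivals_insert_of_not fun h' => h q h1 h'.1.symm]

open Classical in
lemma card_acceptedOf_insert_le [DecidableEq ι] :
    (acceptedOf L t g B (insert p S) j).card ≤
      (acceptedOf L t g B S j).card + if t p = j then 1 else 0 := by
  unfold acceptedOf
  refine (Finset.card_le_card (Finset.filter_subset_filter _ accepted_insert_subset)).trans ?_
  rw [Finset.filter_insert]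
  split_ifs with h
  · exact Finset.card_insert_le _ _
  · simp

lemma card_acceptedOf_le_insert [DecidableEq ι] [IsStrictTotalOrder ι B] :
    (acceptedOf L t g B S j).card ≤ (acceptedOf L t g B (insert p S) j).card + 1 := by
  classical
  have h4 := displaced_card_le (L := L) (g := g) (B := B) (S := S) (p := p)
  unfold acceptedOf
  set P := accepted L g B S
  set Q := accepted L g B (insert p S)
  have : P.filter (fun p => t p = j) ⊆ Q.filter (fun p => t p = j) ∪ (P \ Q) := by
    intro x; simp only [Finset.mem_filter, Finset.mem_union, Finset.mem_sdiff]; tauto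
  exact (Finset.card_le_card this).trans ((Finset.card_union_le _ _).trans (by omega))

lemma rivals_congr {U' : Type*} {g' : ι → U'} {B' : ι → ι → Prop}
    (hg : ∀ x ∈ S, ∀ y ∈ S, (g x = g y ↔ g' x = g' y)) (hB : ∀ x ∈ S, ∀ y ∈ S, (B x y ↔ B' x y))
    (hp : p ∈ S) : rivals g B S p = rivals g' B' S p := by
  ext x; simp only [mem_rivals]
  constructor
  · rintro ⟨a, b, c⟩; exact ⟨a, (hg x a p hp).1 b, (hB x a p hp).1 c⟩
  · rintro ⟨a, b, c⟩; exact ⟨a, (hg x a p hp).2 b, (hB x a p hp).2 c⟩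

lemma accepted_congr {U' : Type*} {g' : ι → U'} {B' : ι → ι → Prop}
    (hg : ∀ x ∈ S, ∀ y ∈ S, (g x = g y ↔ g' x = g' y))
    (hB : ∀ x ∈ S, ∀ y ∈ S, (B x y ↔ B' x y)) : accepted L g B S = accepted L g' B' S := by
  ext x; simp only [mem_accepted]
  refine and_congr_right fun hx => ?_
  rw [rivals_congr hg hB hx]

lemma acceptedOf_congr {U' : Type*} {g' : ι → U'} {B' : ι → ι → Prop}
    (hg : ∀ x ∈ S, ∀ y ∈ S, (g x = g y ↔ g' x = g' y))
    (hB : ∀ x ∈ S, ∀ y ∈ S, (B x y ↔ B' x y)) :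
    acceptedOf L t g B S j = acceptedOf L t g' B' S j := by
  unfold acceptedOf
  rw [accepted_congr hg hB]

lemma rivals_map {ι' : Type*} (e : ι' ↪ ι) (S : Finset ι') (p : ι') :
    rivals g B (S.map e) (e p) = (rivals (g ∘ e) (fun x y => B (e x) (e y)) S p).map e := by
  ext x; simp only [mem_rivals, Finset.mem_map, Function.comp]
  constructor
  · rintro ⟨⟨y, hy, rfl⟩, h⟩; exact ⟨y, ⟨hy, h⟩, rfl⟩
  · rintro ⟨y, ⟨hy, h⟩, rfl⟩; exact ⟨⟨y, hy, rfl⟩, h⟩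

lemma acceptedOf_map {ι' : Type*} (e : ι' ↪ ι) (S : Finset ι') :
    acceptedOf L t g B (S.map e) j =
      (acceptedOf L (t ∘ e) (g ∘ e) (fun x y => B (e x) (e y)) S j).map e := by
  ext x
  simp only [acceptedOf, mem_accepted, Finset.mem_map, Finset.mem_filter, Function.comp]
  constructor
  · rintro ⟨⟨⟨y, hy, rfl⟩, h⟩, h'⟩
    rw [rivals_map, Finset.card_map] at h
    exact ⟨y, ⟨⟨hy, h⟩, h'⟩, rfl⟩
  · rintro ⟨y, ⟨⟨hy, h⟩, h'⟩, rfl⟩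
    refine ⟨⟨⟨y, hy, rfl⟩, ?_⟩, h'⟩
    rwa [rivals_map, Finset.card_map]

/-- Otherwise take a best rival of `p` that is not accepted. All its own rivals are accepted rivals
of `p`, hence fewer than `L`, so it is accepted after all. This makes `RejectedJustly` an invariant
of the rounds. -/
lemma le_card_accepted_of_le_card [Std.Irrefl B] [IsTrans ι B] (h : L ≤ (rivals g B S p).card) :
    L ≤ (rivals g B (accepted L g B S) p).card := by
  classical
  by_contra hlt
  push Not at hlt
  obtain ⟨x, hx, hmin⟩ : ∃ x ∈ rivals g B S p \ rivals g B (accepted L g B S) p,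
      ∀ y ∈ rivals g B S p \ rivals g B (accepted L g B S) p, ¬ B y x := by
    have hne : (rivals g B S p \ rivals g B (accepted L g B S) p).Nonempty := by
      rw [Finset.nonempty_iff_ne_empty, Ne, Finset.sdiff_eq_empty_iff_subset]
      intro hs
      exact absurd (Finset.card_le_card hs) (by omega)
    let P := rivals g B S p \ rivals g B (accepted L g B S) p
    obtain ⟨x, hx, hm⟩ := Finset.exists_min_image P (fun x => (rivals g B S x).card) hne
    refine ⟨x, hx, fun y hy hB => ?_⟩
    obtain ⟨y1, y2, y3⟩ := mem_rivals.1 (Finset.mem_sdiff.1 hy).1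
    obtain ⟨x1, x2, x3⟩ := mem_rivals.1 (Finset.mem_sdiff.1 hx).1
    have := rivals_card_lt (S := S) (y2.trans x2.symm) y1 hB
    exact absurd (hm y hy) (by omega)
  obtain ⟨hx1, hx2⟩ := Finset.mem_sdiff.1 hx
  obtain ⟨x1, x2, x3⟩ := mem_rivals.1 hx1
  apply hx2
  refine mem_rivals.2 ⟨mem_accepted.2 ⟨x1, lt_of_le_of_lt (Finset.card_le_card ?_) hlt⟩, x2, x3⟩
  intro y hy
  obtain ⟨y1, y2, y3⟩ := mem_rivals.1 hy
  by_contra hy'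
  exact hmin y (Finset.mem_sdiff.2 ⟨mem_rivals.2 ⟨y1, y2.trans x2, trans_of B y3 x3⟩, hy'⟩) y3

end Acceptance

/-! ### Deferred acceptance on abstract proposals -/

section DeferredAcceptance

variable {n K : ℕ} {U : Type*}

/-- The proposals that are pending after the rejections `r`. -/
def pending (K : ℕ) {n : ℕ} (r : Fin n → ℕ) : Finset (Fin n × Fin K) :=
  Finset.univ.filter fun p => (p.2 : ℕ) = r p.1

/-- The proposals that have been made after the rejections `r`. -/
def made (K : ℕ) {n : ℕ} (r : Fin n → ℕ) : Finset (Fin n × Fin K) :=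
  Finset.univ.filter fun p => (p.2 : ℕ) ≤ r p.1

lemma mem_pending {r : Fin n → ℕ} {p : Fin n × Fin K} : p ∈ pending K r ↔ (p.2 : ℕ) = r p.1 := by
  simp [pending]

lemma mem_made {r : Fin n → ℕ} {p : Fin n × Fin K} : p ∈ made K r ↔ (p.2 : ℕ) ≤ r p.1 := by
  simp [made]

lemma pending_subset_made (r : Fin n → ℕ) : pending K r ⊆ made K r := by
  intro p; simp only [mem_pending, mem_made]; omega

variable (L : ℕ) (g : Fin n × Fin K → U) (B : Fin n × Fin K → Fin n × Fin K → Prop)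

open Classical in
/-- A round of deferred acceptance. -/
def rejectStep (r : Fin n → ℕ) : Fin n → ℕ := fun s =>
  if ∃ p ∈ pending K r, p.1 = s ∧ p ∉ accepted L g B (pending K r) then r s + 1 else r s

/-- The rejections after `T` rounds. -/
def rejections (T : ℕ) : Fin n → ℕ := (rejectStep L g B)^[T] fun _ => 0

lemma rejections_succ (T : ℕ) :
    rejections L g B (T + 1) = rejectStep L g B (rejections L g B T) := by
  simp only [rejections, Function.iterate_succ_apply']

lemma le_rejectStep (r : Fin n → ℕ) (s : Fin n) : r s ≤ rejectStep L g B r s := by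
  unfold rejectStep; split_ifs <;> omega

lemma rejectStep_le (r : Fin n → ℕ) (hr : ∀ s, r s ≤ K) (s : Fin n) : rejectStep L g B r s ≤ K := by
  unfold rejectStep; split_ifs with h
  · obtain ⟨p, hp, rfl, -⟩ := h
    rw [mem_pending] at hp
    have := p.2.2; omega
  · exact hr s

lemma rejections_le (T : ℕ) (s : Fin n) : rejections L g B T s ≤ K := by
  induction T generalizing s with
  | zero => exact Nat.zero_le _
  | succ T ih => rw [rejections_succ]; exact rejectStep_le L g B _ ih s

lemma rejections_mono {T T' : ℕ} (h : T ≤ T') (s : Fin n) :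
    rejections L g B T s ≤ rejections L g B T' s := by
  induction T', h using Nat.le_induction with
  | base => exact le_rfl
  | succ T' _ ih => rw [rejections_succ]; exact ih.trans (le_rejectStep L g B _ s)

/-- A round without rejections makes all later rounds idle, so while the process is still moving
every earlier round has contributed at least one rejection. -/
lemma rejections_le_sum (T : ℕ) (h : rejections L g B (T + 1) ≠ rejections L g B T) :
    T + 1 ≤ ∑ s, rejections L g B (T + 1) s := by
  induction T with
  | zero =>
    by_contra h'
    apply h
    have h0 : ∑ s, rejections L g B (0 + 1) s = 0 := by omega
    rw [Finset.sum_eq_zero_iff] at h0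
    funext s; rw [h0 s (Finset.mem_univ s)]; rfl
  | succ T ih =>
    have h1 : rejections L g B (T + 1) ≠ rejections L g B T := by
      intro h'; apply h; rw [rejections_succ, h', ← rejections_succ, h']
    have h2 : ∑ s, rejections L g B (T + 1) s < ∑ s, rejections L g B (T + 1 + 1) s := by
      apply Finset.sum_lt_sum (fun s _ => rejections_mono L g B (Nat.le_succ _) s)
      by_contra hc
      push Not at hc
      exact h (funext fun s => le_antisymm (hc s (Finset.mem_univ s))
        (rejections_mono L g B (Nat.le_succ _) s))
    have := ih h1
    omega

/-- Deferred acceptance is stationary after `n * K` rounds. -/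
lemma rejections_stationary :
    rejectStep L g B (rejections L g B (n * K)) = rejections L g B (n * K) := by
  rw [← rejections_succ]
  by_contra h
  have h1 := rejections_le_sum L g B _ h
  have h2 : ∑ s, rejections L g B (n * K + 1) s ≤ ∑ _s : Fin n, K :=
    Finset.sum_le_sum fun s _ => rejections_le L g B _ s
  simp at h2
  omega

/-- Every proposal that was rejected would be rejected against the pending proposals. -/
def RejectedJustly (r : Fin n → ℕ) : Prop :=
  ∀ p : Fin n × Fin K, (p.2 : ℕ) < r p.1 → L ≤ (rivals g B (pending K r) p).card

variable {L g B}

lemma accepted_pending_subset (r : Fin n → ℕ) :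
    accepted L g B (pending K r) ⊆ pending K (rejectStep L g B r) := by
  intro p hp
  have h := mem_pending.1 (accepted_subset hp)
  rw [mem_pending, rejectStep, if_neg, h]
  rintro ⟨q, hq, hqp, hq'⟩
  have : q = p := by
    rw [mem_pending] at hq
    refine Prod.ext hqp (Fin.ext ?_)
    rw [hq, h, hqp]
  exact hq' (this ▸ hp)

lemma RejectedJustly.step [Std.Irrefl B] [IsTrans _ B] {r : Fin n → ℕ}
    (h : RejectedJustly L g B r) : RejectedJustly L g B (rejectStep L g B r) := by
  intro p hp
  have h1 : L ≤ (rivals g B (pending K r) p).card := by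
    by_cases hp' : (p.2 : ℕ) < r p.1
    · exact h p hp'
    · unfold rejectStep at hp
      split_ifs at hp with hc
      swap
      · exact absurd hp hp'
      obtain ⟨q, hq, hqp, hq'⟩ := hc
      have hpq : q = p := by
        rw [mem_pending] at hq
        refine Prod.ext hqp (Fin.ext ?_)
        rw [hq, hqp]; omega
      subst hpq
      by_contra hlt
      exact hq' (mem_accepted.2 ⟨hq, by omega⟩)
  exact (le_card_accepted_of_le_card h1).trans
    (Finset.card_le_card (rivals_mono (accepted_pending_subset r)))

lemma rejectedJustly_rejections [Std.Irrefl B] [IsTrans _ B] (T : ℕ) :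
    RejectedJustly L g B (rejections L g B T) := by
  induction T with
  | zero => intro p hp; simp [rejections] at hp
  | succ T ih => rw [rejections_succ]; exact ih.step

/-- At the end of deferred acceptance the universities hold their best `L` proposals. -/
lemma accepted_made [Std.Irrefl B] [IsTrans _ B] {r : Fin n → ℕ}
    (h : RejectedJustly L g B r) (hr : rejectStep L g B r = r) :
    accepted L g B (made K r) = pending K r := by
  have hacc : ∀ p ∈ pending K r, p ∈ accepted L g B (pending K r) := by
    intro p hp
    by_contra hn
    have := congrFun hr p.1
    rw [rejectStep, if_pos ⟨p, hp, rfl, hn⟩] at this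
    omega
  ext p
  constructor
  · intro hp
    obtain ⟨h1, h2⟩ := mem_accepted.1 hp
    rw [mem_made] at h1
    rw [mem_pending]
    by_contra hne
    have h3 := h p (by omega)
    have h4 := Finset.card_le_card
      (rivals_mono (g := g) (B := B) (p := p) (pending_subset_made (K := K) r))
    omega
  · intro hp
    have h1 := hacc p hp
    refine mem_accepted.2 ⟨pending_subset_made r hp, ?_⟩
    refine (Finset.card_le_card ?_).trans_lt (mem_accepted.1 h1).2
    -- A rival `q` that is no longer pending was rejected justly: `L` pending proposals beat `q`,
    -- hence also `p`, which contradicts the acceptance of `p`.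
    intro q hq
    obtain ⟨q1, q2, q3⟩ := mem_rivals.1 hq
    refine mem_rivals.2 ⟨?_, q2, q3⟩
    rw [mem_made] at q1
    rw [mem_pending]
    by_contra hne
    have h3 := h q (by omega)
    have h4 : (rivals g B (pending K r) q).card ≤ (rivals g B (pending K r) p).card := by
      apply Finset.card_le_card
      intro x hx
      obtain ⟨a, b, c⟩ := mem_rivals.1 hx
      exact mem_rivals.2 ⟨a, b.trans q2, trans_of B c q3⟩
    have := (mem_accepted.1 h1).2
    omega

/-- The number of students who make a proposal of type `j` (counted from `0`). -/
def proposers {n : ℕ} (r : Fin n → ℕ) (j : ℕ) : ℕ := (Finset.univ.filter fun s => j ≤ r s).card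

/-- A student who made a proposal of type `j` stops there exactly if it is still pending at the end,
and the proposals pending at the end are the accepted ones. -/
lemma proposers_succ [Std.Irrefl B] [IsTrans _ B] {r : Fin n → ℕ}
    (h : RejectedJustly L g B r) (hr : rejectStep L g B r = r) (j : Fin K) :
    proposers r (j + 1) + (acceptedOf L Prod.snd g B (made K r) j).card = proposers r j := by
  have h1 : (acceptedOf L Prod.snd g B (made K r) j).card =
      (Finset.univ.filter fun s => (j : ℕ) = r s).card := by
    refine Finset.card_bij (fun p _ => p.1) ?_ ?_ ?_
    · intro p hp
      rw [mem_acceptedOf, accepted_made h hr, mem_pending] at hp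
      simp [← hp.1, hp.2]
    · intro p hp q hq hpq
      rw [mem_acceptedOf] at hp hq
      exact Prod.ext hpq (hp.2.trans hq.2.symm)
    · intro s hs
      refine ⟨(s, j), ?_, rfl⟩
      rw [mem_acceptedOf, accepted_made h hr, mem_pending]
      simpa using hs
  rw [h1, proposers, proposers, ← Finset.card_union_of_disjoint]
  · congr 1; ext s; simp; omega
  · rw [Finset.disjoint_left]; intro s; simp; omega

end DeferredAcceptance

/-! ### Listing the proposals of each type in the order in which they are made -/

section Rank

variable {n : ℕ}

/-- The students that precede `s` when they are sorted by `f`, and by index for equal values. -/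
def predecessors (f : Fin n → ℕ) (s : Fin n) : Finset (Fin n) :=
  Finset.univ.filter fun s' => f s' < f s ∨ (f s' = f s ∧ s' < s)

lemma mem_predecessors {f : Fin n → ℕ} {s s' : Fin n} :
    s' ∈ predecessors f s ↔ f s' < f s ∨ (f s' = f s ∧ s' < s) := by simp [predecessors]

lemma predecessors_card_lt (f : Fin n → ℕ) (s : Fin n) : (predecessors f s).card < n := by
  have : predecessors f s ⊂ Finset.univ := by
    rw [Finset.ssubset_univ_iff]
    intro h
    have := h ▸ Finset.mem_univ s
    simp [mem_predecessors] at this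
  simpa using Finset.card_lt_card this

lemma predecessors_card_lt_of (f : Fin n → ℕ) {s s' : Fin n}
    (h : f s < f s' ∨ (f s = f s' ∧ s < s')) :
    (predecessors f s).card < (predecessors f s').card := by
  apply Finset.card_lt_card
  rw [Finset.ssubset_iff_of_subset]
  · exact ⟨s, mem_predecessors.2 h, by simp [mem_predecessors]⟩
  · intro x; simp only [mem_predecessors]; omega

/-- The permutation that sends every student to her rank. -/
def rankPerm (f : Fin n → ℕ) : Equiv.Perm (Fin n) :=
  Equiv.ofBijective (fun s => ⟨(predecessors f s).card, predecessors_card_lt f s⟩) <| by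
    apply Function.Injective.bijective_of_finite
    intro s s' h
    by_contra hne
    have h1 : (predecessors f s).card = (predecessors f s').card := congrArg Fin.val h
    have h2 : (f s < f s' ∨ (f s = f s' ∧ s < s')) ∨ (f s' < f s ∨ (f s' = f s ∧ s' < s)) := by
      omega
    rcases h2 with h2 | h2
    · have := predecessors_card_lt_of f h2; omega
    · have := predecessors_card_lt_of f h2; omega

lemma rankPerm_val (f : Fin n → ℕ) (s : Fin n) :
    (rankPerm f s : ℕ) = (predecessors f s).card := rfl

lemma rankPerm_lt_iff (f : Fin n → ℕ) (t : ℕ) (s : Fin n) :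
    (rankPerm f s : ℕ) < (Finset.univ.filter fun s => f s ≤ t).card ↔ f s ≤ t := by
  rw [rankPerm_val]
  constructor
  · intro h
    by_contra hs
    refine absurd (Finset.card_le_card ?_) (not_le.2 h)
    intro x hx
    simp only [Finset.mem_filter, Finset.mem_univ, true_and] at hx
    exact mem_predecessors.2 (Or.inl (by omega))
  · intro h
    apply Finset.card_lt_card
    rw [Finset.ssubset_iff_of_subset]
    · exact ⟨s, by simpa using h, by simp [mem_predecessors]⟩
    · intro x; simp only [mem_predecessors, Finset.mem_filter, Finset.mem_univ, true_and]; omega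

/-- The rank of a student with value at most `t` is determined by the level sets up to `t`. Thus
positions in the time order are settled as soon as the proposals are made, without looking ahead. -/
lemma rankPerm_congr {f f' : Fin n → ℕ} {t : ℕ} (h : ∀ u ≤ t, ∀ s, f s ≤ u ↔ f' s ≤ u)
    {s : Fin n} (hs : f s ≤ t) : rankPerm f s = rankPerm f' s := by
  have key : ∀ s, f s ≤ t → f' s = f s := by
    intro s hs
    have h1 : f' s ≤ f s := (h _ hs s).1 le_rfl
    exact le_antisymm h1 ((h (f' s) (h1.trans hs) s).2 le_rfl)
  apply Fin.ext
  rw [rankPerm_val, rankPerm_val]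
  congr 1
  ext x
  simp only [mem_predecessors]
  rw [key s hs]
  by_cases hx : f x ≤ t
  · rw [key x hx]
  · have : ¬ f' x ≤ t := fun h' => hx ((h t le_rfl x).2 h')
    omega

end Rank

/-! ### The time order of the proposals and its adaptivity -/

section Order

variable {n K : ℕ} {U : Type*} (L : ℕ) (g : Fin n × Fin K → U)
  (B : Fin n × Fin K → Fin n × Fin K → Prop)

/-- The first round in which `s` has been rejected `j` times. -/
def firstRound (j : ℕ) (s : Fin n) : ℕ :=
  ((Finset.range (n * K + 1)).filter fun t => rejections L g B t s < j).card

/-- Rejections are monotone in time, so counting the rounds before the threshold gives the first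
round at or after it. A student who never gets `j` rejections has the value `n * K + 1` and is
sorted last. -/
lemma firstRound_le_iff {t : ℕ} (ht : t ≤ n * K) (j : ℕ) (s : Fin n) :
    firstRound L g B j s ≤ t ↔ j ≤ rejections L g B t s := by
  constructor
  · intro h
    by_contra hlt
    push Not at hlt
    have : Finset.range (t + 1) ⊆
        (Finset.range (n * K + 1)).filter fun t => rejections L g B t s < j := by
      intro u hu
      rw [Finset.mem_range] at hu
      rw [Finset.mem_filter, Finset.mem_range]
      exact ⟨by omega, (rejections_mono L g B (by omega) s).trans_lt hlt⟩
    have := Finset.card_le_card this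
    rw [Finset.card_range] at this
    unfold firstRound at h
    omega
  · intro h
    have : ((Finset.range (n * K + 1)).filter fun t => rejections L g B t s < j) ⊆
        Finset.range t := by
      intro u hu
      rw [Finset.mem_filter] at hu
      rw [Finset.mem_range]
      by_contra hc
      have := rejections_mono L g B (not_lt.1 hc) s
      omega
    simpa [firstRound] using Finset.card_le_card this

/-- The permutation of the proposals that lists the proposals of each type in the order in which
they are made. -/
def timeOrder : Equiv.Perm (Fin n × Fin K) where
  toFun p := (rankPerm (firstRound L g B p.2) p.1, p.2)
  invFun p := ((rankPerm (firstRound L g B p.2)).symm p.1, p.2)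
  left_inv p := by simp
  right_inv p := by simp

lemma timeOrder_apply (p : Fin n × Fin K) :
    timeOrder L g B p = (rankPerm (firstRound L g B p.2) p.1, p.2) := rfl

/-- The first `a j` proposals of each type `j`. -/
def initialProposals (n : ℕ) {K : ℕ} (a : Fin K → ℕ) : Finset (Fin n × Fin K) :=
  Finset.univ.filter fun p => (p.1 : ℕ) < a p.2

lemma mem_initialProposals {a : Fin K → ℕ} {p : Fin n × Fin K} :
    p ∈ initialProposals n a ↔ (p.1 : ℕ) < a p.2 := by simp [initialProposals]

/-- The proposals of type `j` that are ever made are those with first round at most `n * K`, and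
sorting puts these in front. -/
lemma map_made_timeOrder :
    (made K (rejections L g B (n * K))).map (timeOrder L g B).toEmbedding =
      initialProposals n fun j : Fin K => proposers (rejections L g B (n * K)) j := by
  ext p
  rw [Finset.mem_map_equiv, mem_initialProposals]
  obtain ⟨q, rfl⟩ := (timeOrder L g B).surjective p
  rw [Equiv.symm_apply_apply, mem_made, timeOrder_apply, ← firstRound_le_iff L g B le_rfl,
    ← rankPerm_lt_iff]
  simp only [proposers, firstRound_le_iff L g B le_rfl]

lemma proposers_recursion [Std.Irrefl B] [IsTrans _ B] (j : Fin K) :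
    proposers (rejections L g B (n * K)) (j + 1) +
      (acceptedOf L Prod.snd (g ∘ (timeOrder L g B).symm)
        (fun p q => B ((timeOrder L g B).symm p) ((timeOrder L g B).symm q))
        (initialProposals n fun j : Fin K => proposers (rejections L g B (n * K)) j) j).card =
      proposers (rejections L g B (n * K)) j := by
  rw [← proposers_succ (rejectedJustly_rejections (L := L) (g := g) (B := B) (n * K))
    (rejections_stationary L g B) j, ← map_made_timeOrder, acceptedOf_map, Finset.card_map]
  congr 3
  · ext p; simp
  · ext p q; simp

variable {L g B} {g' : Fin n × Fin K → U} {B' : Fin n × Fin K → Fin n × Fin K → Prop}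

/-- The reordered data determine the whole run. By induction, equal histories up to round `t` put
each pending proposal in the same place of both lists, so both runs read the same universities and
comparisons and reject the same students. -/
lemma rejections_eq_of_reordered_eq
    (hg : g ∘ (timeOrder L g B).symm = g' ∘ (timeOrder L g' B').symm)
    (hB : (fun p q => B ((timeOrder L g B).symm p) ((timeOrder L g B).symm q)) =
      fun p q => B' ((timeOrder L g' B').symm p) ((timeOrder L g' B').symm q)) :
    ∀ t ≤ n * K, rejections L g B t = rejections L g' B' t := by
  intro t
  induction t using Nat.strong_induction_on with
  | _ t ih =>
    rcases t with _ | t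
    · intro _; rfl
    intro ht
    have key : ∀ p ∈ pending K (rejections L g B t), timeOrder L g B p = timeOrder L g' B' p := by
      intro p hp
      rw [mem_pending] at hp
      rw [timeOrder_apply, timeOrder_apply]
      refine Prod.ext (rankPerm_congr (t := t) ?_ ?_) rfl
      · intro u hu s
        rw [firstRound_le_iff L g B (by omega), firstRound_le_iff L g' B' (by omega),
          ih u (by omega) (by omega)]
      · rw [firstRound_le_iff L g B (by omega), hp]
    rw [rejections_succ, rejections_succ, ← ih t (by omega) (by omega)]
    have hacc : accepted L g B (pending K (rejections L g B t)) =
        accepted L g' B' (pending K (rejections L g B t)) := by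
      have hg1 : ∀ p ∈ pending K (rejections L g B t), g p = g' p := by
        intro p hp
        have := congrFun hg (timeOrder L g B p)
        simp only [Function.comp, Equiv.symm_apply_apply] at this
        rw [this, key p hp, Equiv.symm_apply_apply]
      apply accepted_congr
      · intro p hp q hq
        rw [hg1 p hp, hg1 q hq]
      · intro p hp q hq
        have := congrFun (congrFun hB (timeOrder L g B p)) (timeOrder L g B q)
        simp only [Equiv.symm_apply_apply] at this
        rw [this, key p hp, key q hq, Equiv.symm_apply_apply, Equiv.symm_apply_apply]
    unfold rejectStep
    rw [hacc]

lemma timeOrder_eq_of_reordered_eq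
    (hg : g ∘ (timeOrder L g B).symm = g' ∘ (timeOrder L g' B').symm)
    (hB : (fun p q => B ((timeOrder L g B).symm p) ((timeOrder L g B).symm q)) =
      fun p q => B' ((timeOrder L g' B').symm p) ((timeOrder L g' B').symm q)) :
    timeOrder L g B = timeOrder L g' B' := by
  have h := rejections_eq_of_reordered_eq hg hB
  ext1 p
  rw [timeOrder_apply, timeOrder_apply]
  have : firstRound L g B p.2 = firstRound L g' B' p.2 := by
    funext s
    unfold firstRound
    congr 1
    apply Finset.filter_congr
    intro t ht
    rw [Finset.mem_range] at ht
    rw [h t (by omega)]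
  rw [this]

end Order

/-! ### Adaptive rearrangements -/

/-- An injective map that is piecewise measure preserving does not increase measures of
preimages. -/
lemma measure_preimage_le_of_piecewise {Ω Γ : Type*} [MeasurableSpace Ω] [Fintype Γ]
    (μ : Measure Ω) (ρ : Ω → Γ) (hρ : ∀ γ, MeasurableSet (ρ ⁻¹' {γ})) (T : Γ → Ω ≃ᵐ Ω)
    (hT : ∀ γ, MeasurePreserving (T γ) μ μ) (hinj : Function.Injective fun ω => T (ρ ω) ω)
    {A : Set Ω} (hA : MeasurableSet A) : μ ((fun ω => T (ρ ω) ω) ⁻¹' A) ≤ μ A := by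
  have h1 : (fun ω => T (ρ ω) ω) ⁻¹' A ⊆ ⋃ γ, (ρ ⁻¹' {γ} ∩ T γ ⁻¹' A) := by
    intro ω hω
    exact Set.mem_iUnion.2 ⟨ρ ω, rfl, hω⟩
  -- Each piece is carried to its image under `T γ`. Injectivity of the glued map makes these images
  -- disjoint, so the measures of their parts in `A` add up to at most that of `A`.
  have h2 : ∀ γ, μ (ρ ⁻¹' {γ} ∩ T γ ⁻¹' A) = μ ((T γ).symm ⁻¹' (ρ ⁻¹' {γ}) ∩ A) := by
    intro γ
    rw [← (hT γ).measure_preimage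
      ((((T γ).symm.measurable (hρ γ))).inter hA).nullMeasurableSet]
    congr 1
    ext ω; simp
  calc μ ((fun ω => T (ρ ω) ω) ⁻¹' A) ≤ ∑ γ, μ (ρ ⁻¹' {γ} ∩ T γ ⁻¹' A) :=
        (measure_mono h1).trans ((measure_iUnion_le _).trans (by rw [tsum_fintype]))
    _ = μ (⋃ γ, ((T γ).symm ⁻¹' (ρ ⁻¹' {γ}) ∩ A)) := by
        rw [measure_iUnion, tsum_fintype]
        · exact Finset.sum_congr rfl fun γ _ => h2 γ
        · intro γ γ' hne
          rw [Function.onFun, Set.disjoint_left]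
          rintro ω ⟨h, -⟩ ⟨h', -⟩
          apply hne
          have e1 : ρ ((T γ).symm ω) = γ := h
          have e2 : ρ ((T γ').symm ω) = γ' := h'
          have : (T γ).symm ω = (T γ').symm ω := hinj (by simp [e1, e2])
          rw [← e1, ← e2, this]
        · exact fun γ => ((T γ).symm.measurable (hρ γ)).inter hA
    _ ≤ μ A := measure_mono (Set.iUnion_subset fun γ => Set.inter_subset_right)

/-! ### Variance of functions with bounded differences -/

section BoundedDifferences

open ProbabilityTheory

lemma integrable_of_abs_le {Ω : Type*} [MeasurableSpace Ω] {μ : Measure Ω} [IsFiniteMeasure μ]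
    {f : Ω → ℝ} (hf : Measurable f) {C : ℝ} (hC : ∀ x, |f x| ≤ C) : Integrable f μ :=
  Integrable.of_bound hf.aestronglyMeasurable C (ae_of_all _ fun x => hC x)

lemma memLp_two_of_abs_le {Ω : Type*} [MeasurableSpace Ω] {μ : Measure Ω} [IsFiniteMeasure μ]
    {f : Ω → ℝ} (hf : Measurable f) {C : ℝ} (hC : ∀ x, |f x| ≤ C) : MemLp f 2 μ :=
  MemLp.of_bound hf.aestronglyMeasurable C (ae_of_all _ fun x => hC x)

/-- The variance of a function of two independent variables. -/
lemma variance_prod_le {X Y : Type*} [MeasurableSpace X] [MeasurableSpace Y] {μ : Measure X}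
    {ν : Measure Y} [IsProbabilityMeasure μ] [IsProbabilityMeasure ν] {F : X × Y → ℝ}
    (hF : Measurable F) {C : ℝ} (hC : ∀ z, |F z| ≤ C) {c : ℝ}
    (hc : ∀ x x' y, |F (x, y) - F (x', y)| ≤ c) :
    Var[F; μ.prod ν] ≤ c ^ 2 + Var[fun y => ∫ x, F (x, y) ∂μ; ν] := by
  set G : Y → ℝ := fun y => ∫ x, F (x, y) ∂μ with hG
  have hGm : Measurable G := (hF.stronglyMeasurable.integral_prod_left').measurable
  have hGC : ∀ y, |G y| ≤ C := by
    intro y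
    have := norm_integral_le_of_norm_le_const (μ := μ) (f := fun x => F (x, y)) (C := C)
      (ae_of_all _ fun x => hC _)
    simpa using this
  have hsec : ∀ y, Measurable fun x => F (x, y) := fun y => hF.comp (by fun_prop)
  have hFG : ∀ x y, |F (x, y) - G y| ≤ c := by
    intro x y
    have h1 : F (x, y) - G y = ∫ x', (F (x, y) - F (x', y)) ∂μ := by
      rw [integral_sub (integrable_const _) (integrable_of_abs_le (hsec y) fun x => hC _)]
      simp [hG]
    rw [h1]
    have := norm_integral_le_of_norm_le_const (μ := μ) (f := fun x' => F (x, y) - F (x', y))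
      (C := c) (ae_of_all _ fun x' => hc _ _ _)
    simpa using this
  have hsq : ∀ {a b : ℝ}, |a| ≤ b → |a ^ 2| ≤ b ^ 2 := by
    intro a b h
    rw [abs_pow]
    exact pow_le_pow_left₀ (abs_nonneg _) h 2
  have hI2 : Integrable (fun z => F z ^ 2) (μ.prod ν) :=
    integrable_of_abs_le (hF.pow_const 2) fun z => hsq (hC z)
  -- The conditional variance is at most `c ^ 2`, because `F` stays within `c` of its conditional
  -- mean `G`.
  have h2 : ∀ y, ∫ x, F (x, y) ^ 2 ∂μ ≤ c ^ 2 + G y ^ 2 := by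
    intro y
    have hm := memLp_two_of_abs_le (μ := μ) (hsec y) fun x => hC _
    have e1 := variance_eq_sub hm
    have e2 := variance_eq_integral (μ := μ) (hsec y).aemeasurable
    have e3 : ∫ x, (F (x, y) - G y) ^ 2 ∂μ ≤ c ^ 2 := by
      have := norm_integral_le_of_norm_le_const (μ := μ) (f := fun x => (F (x, y) - G y) ^ 2)
        (C := c ^ 2) (ae_of_all _ fun x => hsq (hFG x y))
      simp only [Real.norm_eq_abs, probReal_univ, mul_one] at this
      exact (le_abs_self _).trans this
    simp only [Pi.pow_apply] at e1
    change _ = ∫ x, (F (x, y) - G y) ^ 2 ∂μ at e2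
    have e4 : Var[fun x => F (x, y); μ] = ∫ x, F (x, y) ^ 2 ∂μ - G y ^ 2 := e1
    linarith
  rw [variance_eq_sub (memLp_two_of_abs_le hF hC), variance_eq_sub (memLp_two_of_abs_le hGm hGC)]
  have h3 : ∫ z, F z ∂(μ.prod ν) = ∫ y, G y ∂ν :=
    integral_prod_symm _ (integrable_of_abs_le hF hC)
  have h4 : ∫ z, F z ^ 2 ∂(μ.prod ν) = ∫ y, ∫ x, F (x, y) ^ 2 ∂μ ∂ν := integral_prod_symm _ hI2
  have h5 : ∫ y, ∫ x, F (x, y) ^ 2 ∂μ ∂ν ≤ ∫ y, (c ^ 2 + G y ^ 2) ∂ν := by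
    apply integral_mono hI2.integral_prod_right
      ((integrable_const _).add (integrable_of_abs_le (hGm.pow_const 2) fun z => hsq (hGC z)))
    exact h2
  rw [integral_add (integrable_const _)
    (integrable_of_abs_le (hGm.pow_const 2) fun z => hsq (hGC z))] at h5
  simp only [integral_const, probReal_univ, one_smul] at h5
  simp only [Pi.pow_apply]
  rw [h3, h4]
  linarith

/-- Integrate out one coordinate at a time: each costs `c ^ 2`, and the averaged function still has
differences bounded by `c` in the remaining coordinates. -/
lemma variance_pi_fin_le {E : Type*} [MeasurableSpace E] {n : ℕ} (μ : Fin n → Measure E)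
    [∀ i, IsProbabilityMeasure (μ i)] {f : (Fin n → E) → ℝ} (hf : Measurable f) {C : ℝ}
    (hC : ∀ x, |f x| ≤ C) {c : ℝ}
    (hc : ∀ i x y, (∀ k, k ≠ i → x k = y k) → |f x - f y| ≤ c) :
    Var[f; Measure.pi μ] ≤ n * c ^ 2 := by
  induction n with
  | zero =>
    have : f = fun _ => f default := funext fun x => congrArg f (Subsingleton.elim _ _)
    rw [this, variance_eq_integral (by fun_prop)]
    simp
  | succ n ih =>
    have e := measurePreserving_piFinSuccAbove μ 0
    set F : E × (Fin n → E) → ℝ := fun z => f (Fin.cons z.1 z.2) with hFdef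
    have hm : Measurable fun z : E × (Fin n → E) => (Fin.cons z.1 z.2 : Fin (n + 1) → E) := by
      refine measurable_pi_iff.2 fun i => ?_
      refine Fin.cases ?_ (fun j => ?_) i
      · simpa using measurable_fst
      · simp only [Fin.cons_succ]; fun_prop
    have hF : Measurable F := hf.comp hm
    have h1 : Var[f; Measure.pi μ] =
        Var[F; (μ 0).prod (Measure.pi fun j : Fin n => μ ((0 : Fin (n + 1)).succAbove j))] := by
      rw [← e.map_eq, variance_map hF.aemeasurable e.measurable.aemeasurable]
      congr 1
      funext x
      simp only [hFdef, Function.comp]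
      congr 1
      funext i
      refine Fin.cases ?_ (fun j => ?_) i
      · simp [MeasurableEquiv.piFinSuccAbove]
      · simp [MeasurableEquiv.piFinSuccAbove, Fin.tail]
    rw [h1]
    refine (variance_prod_le hF (fun z => hC _) (c := c) ?_).trans ?_
    · intro x x' y
      apply hc 0
      intro k hk
      obtain ⟨j, rfl⟩ := Fin.exists_succ_eq.2 hk
      simp
    · have := ih (fun j : Fin n => μ ((0 : Fin (n + 1)).succAbove j))
        (f := fun y => ∫ x, F (x, y) ∂(μ 0))
        ((hF.stronglyMeasurable.integral_prod_left').measurable) ?_ ?_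
      · push_cast
        linarith
      · intro y
        have := norm_integral_le_of_norm_le_const (μ := μ 0) (f := fun x => F (x, y)) (C := C)
          (ae_of_all _ fun x => hC _)
        simpa using this
      · intro i y y' hy
        have hI : ∀ y, Integrable (fun x => F (x, y)) (μ 0) := fun y =>
          integrable_of_abs_le (hF.comp (by fun_prop)) fun x => hC _
        rw [← integral_sub (hI y) (hI y')]
        have := norm_integral_le_of_norm_le_const (μ := μ 0) (f := fun x => F (x, y) - F (x, y'))
          (C := c) (ae_of_all _ fun x => ?_)
        · simpa using this
        · apply hc i.succ
          intro k
          refine Fin.cases ?_ (fun j => ?_) k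
          · intro _; rfl
          · intro hj
            simp only [Fin.cons_succ]
            exact hy j fun h => hj (by rw [h])

/-- A function of independent variables that changes by at most `c` when one variable changes. -/
lemma variance_pi_le {ι E : Type*} [Fintype ι] [MeasurableSpace E] (μ : ι → Measure E)
    [∀ i, IsProbabilityMeasure (μ i)] {f : (ι → E) → ℝ} (hf : Measurable f) {C : ℝ}
    (hC : ∀ x, |f x| ≤ C) {c : ℝ}
    (hc : ∀ i x y, (∀ k, k ≠ i → x k = y k) → |f x - f y| ≤ c) :
    Var[f; Measure.pi μ] ≤ Fintype.card ι * c ^ 2 := by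
  let e := (Fintype.equivFin ι).symm
  have he := measurePreserving_piCongrLeft (α := fun _ : ι => E) μ e
  rw [← he.map_eq, variance_map hf.aemeasurable he.measurable.aemeasurable]
  refine variance_pi_fin_le (fun i => μ (e i)) (hf.comp he.measurable) (fun x => hC _) ?_
  intro i x y hxy
  apply hc (e i)
  intro k hk
  obtain ⟨j, rfl⟩ := e.surjective k
  rw [MeasurableEquiv.coe_piCongrLeft, Equiv.piCongrLeft_apply_apply,
    Equiv.piCongrLeft_apply_apply]
  exact hxy j fun h => hk (by rw [h])

/-- Restricting independent variables to some of the indices. -/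
lemma map_comp_pi {ι ι' E : Type*} [Fintype ι] [Fintype ι'] [MeasurableSpace E]
    (μ : ι → Measure E) [∀ i, IsProbabilityMeasure (μ i)] {e : ι' → ι}
    (he : Function.Injective e) :
    (Measure.pi μ).map (fun x => x ∘ e) = Measure.pi fun i => μ (e i) := by
  have h1 : iIndepFun (fun (i : ι) (ω : ι → E) => ω i) (Measure.pi μ) :=
    iIndepFun_pi (X := fun _ x => x) fun i => aemeasurable_id
  have h2 := (iIndepFun_iff_map_fun_eq_pi_map fun i => (measurable_pi_apply _).aemeasurable).1 (h1.precomp he)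
  refine Eq.trans h2 ?_
  congr 1
  funext i
  exact (measurePreserving_eval μ (e i)).map_eq

end BoundedDifferences

/-! ### Independent proposals with independent scores -/

section Sample

open ProbabilityTheory

instance isProbabilityMeasure_scoreLaw (D : Measure ℝ) [IsProbabilityMeasure D] :
    IsProbabilityMeasure (scoreLaw D) := by unfold scoreLaw; infer_instance

/-- The score law of a proposal of type `j` (counted from `0`). -/
def typeLaw (D D' : Measure ℝ) (j : ℕ) : Measure Score :=
  if j = 0 then scoreLaw D else scoreLaw D'

instance isProbabilityMeasure_typeLaw (D D' : Measure ℝ) [IsProbabilityMeasure D]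
    [IsProbabilityMeasure D'] (j : ℕ) : IsProbabilityMeasure (typeLaw D D' j) := by
  unfold typeLaw; split_ifs <;> infer_instance

/-- A uniformly random university. -/
def univLaw (N : ℕ) : Measure (Fin N) := uniformOn Set.univ

instance isProbabilityMeasure_univLaw (N : ℕ) [NeZero N] : IsProbabilityMeasure (univLaw N) :=
  isProbabilityMeasure_uniformOn Set.finite_univ Set.univ_nonempty

/-- A family of proposals, each with its university and its score. -/
abbrev Sample (n K N : ℕ) : Type := Fin n × Fin K → Fin N × Score

/-- Independent proposals to uniformly random universities. -/
def sampleLaw (D D' : Measure ℝ) (n K N : ℕ) : Measure (Sample n K N) :=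
  Measure.pi fun p => (univLaw N).prod (typeLaw D D' p.2)

instance isProbabilityMeasure_sampleLaw (D D' : Measure ℝ) [IsProbabilityMeasure D]
    [IsProbabilityMeasure D'] (n K N : ℕ) [NeZero N] :
    IsProbabilityMeasure (sampleLaw D D' n K N) := by
  unfold sampleLaw; infer_instance

variable {ι : Type*} {n K N : ℕ}

/-- The universities of the proposals. -/
def univOf (X : ι → Fin N × Score) (p : ι) : Fin N := (X p).1

/-- The ranking of the proposals by score. -/
def scoreOrder (X : ι → Fin N × Score) (p q : ι) : Prop := Beats (X p).2 (X q).2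

/-- The ranking of the proposals by score, with ties between equal scores broken by index. -/
def strictOrder (X : Sample n K N) (p q : Fin n × Fin K) : Prop :=
  Beats (X p).2 (X q).2 ∨ ((X p).2 = (X q).2 ∧ toLex p < toLex q)

instance irrefl_scoreOrder (X : ι → Fin N × Score) : Std.Irrefl (scoreOrder X) :=
  ⟨fun _ => lt_irrefl _⟩

instance isTrans_scoreOrder (X : ι → Fin N × Score) : IsTrans _ (scoreOrder X) :=
  ⟨fun _ _ _ h h' => lt_trans (α := Lex Score) h' h⟩

instance isStrictTotalOrder_strictOrder (X : Sample n K N) :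
    IsStrictTotalOrder _ (strictOrder X) where
  irrefl p h := by
    rcases h with h | h
    · exact lt_irrefl _ h
    · exact lt_irrefl _ h.2
  trans p q r h h' := by
    rcases h with h | ⟨h1, h2⟩ <;> rcases h' with h' | ⟨h3, h4⟩
    · exact Or.inl (lt_trans (α := Lex Score) h' h)
    · left; unfold Beats at *; rwa [← h3]
    · left; unfold Beats at *; rwa [h1]
    · exact Or.inr ⟨h1.trans h3, h2.trans h4⟩
  trichotomous p q h h' := by
    by_contra hne
    unfold strictOrder Beats at *
    push Not at h h'
    have he : (X p).2 = (X q).2 := toLex.injective (le_antisymm h.1 h'.1)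
    have := le_antisymm (h'.2 he.symm) (h.2 he)
    exact hne (toLex.injective this)

lemma measurableSet_beats : MeasurableSet {z : Score × Score | Beats z.1 z.2} := by
  have : {z : Score × Score | Beats z.1 z.2} =
      {z | z.2.1 < z.1.1} ∪ ({z | z.2.1 = z.1.1} ∩ {z | z.2.2 < z.1.2}) := by
    ext z; simp [Beats, Prod.Lex.toLex_lt_toLex]
  rw [this]
  exact (measurableSet_lt (by fun_prop) (by fun_prop)).union
    ((measurableSet_eq_fun (by fun_prop) (by fun_prop)).inter
      (measurableSet_lt (by fun_prop) (by fun_prop)))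

lemma measurable_univOf : Measurable (univOf : (ι → Fin N × Score) → _) :=
  measurable_pi_iff.2 fun p => measurable_fst.comp (measurable_pi_apply p)

lemma measurable_snd_pair (p q : ι) :
    Measurable fun X : ι → Fin N × Score => ((X p).2, (X q).2) :=
  (measurable_snd.comp (measurable_pi_apply p)).prodMk
    (measurable_snd.comp (measurable_pi_apply q))

lemma measurable_scoreOrder : Measurable (scoreOrder : (ι → Fin N × Score) → _) := by
  refine measurable_pi_iff.2 fun p => measurable_pi_iff.2 fun q => ?_
  exact measurableSet_setOfPred.1 (measurable_snd_pair p q measurableSet_beats)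

lemma measurable_strictOrder : Measurable (strictOrder : Sample n K N → _) := by
  refine measurable_pi_iff.2 fun p => measurable_pi_iff.2 fun q => ?_
  refine measurableSet_setOfPred.1 ((measurable_snd_pair p q measurableSet_beats).union ?_)
  refine MeasurableSet.inter (measurable_snd_pair p q
    (measurableSet_eq_fun measurable_fst measurable_snd)) ?_
  exact MeasurableSet.const _

/-- Any function of the universities and the ranking is measurable. -/
lemma measurable_of_pattern {α : Type*} [MeasurableSpace α]
    (φ : (Fin n × Fin K → Fin N) → (Fin n × Fin K → Fin n × Fin K → Prop) → α) :
    Measurable fun X : Sample n K N => φ (univOf X) (strictOrder X) :=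
  (Measurable.of_discrete (f := fun z : (Fin n × Fin K → Fin N) ×
    (Fin n × Fin K → Fin n × Fin K → Prop) => φ z.1 z.2)).comp
    (measurable_univOf.prodMk measurable_strictOrder)

lemma measurable_of_scorePattern [Finite ι] {α : Type*} [MeasurableSpace α]
    (φ : (ι → Fin N) → (ι → ι → Prop) → α) :
    Measurable fun X : ι → Fin N × Score => φ (univOf X) (scoreOrder X) :=
  (Measurable.of_discrete (f := fun z : (ι → Fin N) × (ι → ι → Prop) => φ z.1 z.2)).comp
    (measurable_univOf.prodMk measurable_scoreOrder)

/-- The samples in which two proposals have the same score. -/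
def tied (n K N : ℕ) : Set (Sample n K N) := {X | ∃ p q, p ≠ q ∧ (X p).2 = (X q).2}

lemma measurableSet_tied : MeasurableSet (tied n K N) := by
  have : tied n K N = ⋃ p, ⋃ q, ⋃ (_ : p ≠ q), {X | (X p).2 = (X q).2} := by
    ext X; simp [tied]
  rw [this]
  exact MeasurableSet.iUnion fun p => MeasurableSet.iUnion fun q => MeasurableSet.iUnion fun _ =>
    measurable_snd_pair p q (measurableSet_eq_fun measurable_fst measurable_snd)

/-- The displacement bounds need a total order for every sample, while the model ranks by score
alone; off a null set the two rankings agree. -/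
lemma strictOrder_eq_scoreOrder {X : Sample n K N} (hX : X ∉ tied n K N) :
    strictOrder X = scoreOrder X := by
  funext p q
  apply propext
  refine or_iff_left ?_
  rintro ⟨h1, h2⟩
  refine hX ⟨p, q, ?_, h1⟩
  rintro rfl
  exact lt_irrefl _ h2

variable (D D' : Measure ℝ) [IsProbabilityMeasure D] [IsProbabilityMeasure D']

lemma typeLaw_label_eq (j : ℕ) (a : unitInterval) : typeLaw D D' j {x | a = x.2} = 0 := by
  have h : ∀ (D : Measure ℝ) [IsProbabilityMeasure D], scoreLaw D {x | a = x.2} = 0 := by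
    intro D _
    have : {x : Score | a = x.2} = Set.univ ×ˢ {a} := by
      ext x; simp [eq_comm]
    rw [this, scoreLaw, Measure.prod_prod]
    simp
  unfold typeLaw; split_ifs
  · exact h D
  · exact h D'

/-- Equal scores have equal tie-breaking labels, and two independent uniform labels almost surely
differ, whatever atoms `D` and `D'` have. -/
lemma sampleLaw_tied [NeZero N] : sampleLaw D D' n K N (tied n K N) = 0 := by
  have h1 : tied n K N ⊆ ⋃ z : {z : (Fin n × Fin K) × (Fin n × Fin K) // z.1 ≠ z.2},
      {X | (X z.1.1).2.2 = (X z.1.2).2.2} := by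
    rintro X ⟨p, q, hpq, h⟩
    exact Set.mem_iUnion.2 ⟨⟨(p, q), hpq⟩, congrArg Prod.snd h⟩
  refine measure_mono_null h1 (measure_iUnion_null ?_)
  rintro ⟨⟨p, q⟩, hpq⟩
  have hind : IndepFun (fun X : Sample n K N => X p) (fun X => X q) (sampleLaw D D' n K N) :=
    (iIndepFun_pi (μ := fun p : Fin n × Fin K => (univLaw N).prod (typeLaw D D' p.2))
      (X := fun _ x => x) fun i => aemeasurable_id).indepFun hpq
  rw [indepFun_iff_map_prod_eq_prod_map_map (measurable_pi_apply p).aemeasurable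
    (measurable_pi_apply q).aemeasurable] at hind
  have e1 : ∀ p, (sampleLaw D D' n K N).map (fun X => X p) =
      (univLaw N).prod (typeLaw D D' p.2) := fun p =>
    (measurePreserving_eval
      (fun p : Fin n × Fin K => (univLaw N).prod (typeLaw D D' p.2)) p).map_eq
  rw [e1, e1] at hind
  have hs : MeasurableSet {z : (Fin N × Score) × (Fin N × Score) | z.1.2.2 = z.2.2.2} :=
    measurableSet_eq_fun (by fun_prop) (by fun_prop)
  have h2 : sampleLaw D D' n K N {X | (X p).2.2 = (X q).2.2} =
      (sampleLaw D D' n K N).map (fun X => (X p, X q))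
        {z : (Fin N × Score) × (Fin N × Score) | z.1.2.2 = z.2.2.2} := by
    rw [Measure.map_apply (by fun_prop) hs]; rfl
  change sampleLaw D D' n K N {X | (X p).2.2 = (X q).2.2} = 0
  rw [h2, hind, Measure.measure_prod_null hs]
  refine ae_of_all _ fun z => ?_
  have : Prod.mk z ⁻¹' {z : (Fin N × Score) × (Fin N × Score) | z.1.2.2 = z.2.2.2} =
      Set.univ ×ˢ {x | z.2.2 = x.2} := by
    ext x; simp
  simp only [this, Measure.prod_prod, typeLaw_label_eq, mul_zero, Pi.zero_apply]

end Sample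

/-! ### The number of accepted proposals -/

section Counts

open ProbabilityTheory

variable {n K N : ℕ}

/-- The number of accepted proposals of type `j` among those in `S`. -/
def acceptedNum (L : ℕ) (S : Finset (Fin n × Fin K)) (j : Fin K) (X : Sample n K N) : ℝ :=
  ((acceptedOf L Prod.snd (univOf X) (strictOrder X) S j).card : ℝ)

/-- The expected number of accepted proposals of type `j` among those in `S`. -/
def meanAccepted (D D' : Measure ℝ) (N L : ℕ) (S : Finset (Fin n × Fin K)) (j : Fin K) : ℝ :=
  ∫ X, acceptedNum L S j X ∂(sampleLaw D D' n K N)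

variable {L : ℕ} {S S' : Finset (Fin n × Fin K)} {j : Fin K}

lemma measurable_acceptedNum : Measurable (acceptedNum (N := N) L S j) :=
  measurable_of_pattern fun g B => ((acceptedOf L Prod.snd g B S j).card : ℝ)

lemma acceptedNum_nonneg (X : Sample n K N) : 0 ≤ acceptedNum L S j X := Nat.cast_nonneg _

lemma acceptedNum_le (X : Sample n K N) : acceptedNum L S j X ≤ n * K := by
  unfold acceptedNum
  calc ((acceptedOf L Prod.snd (univOf X) (strictOrder X) S j).card : ℝ)
      ≤ (Fintype.card (Fin n × Fin K) : ℕ) := by exact_mod_cast Finset.card_le_univ _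
    _ = n * K := by simp

lemma abs_acceptedNum_le (X : Sample n K N) : |acceptedNum L S j X| ≤ n * K := by
  rw [abs_of_nonneg (acceptedNum_nonneg X)]; exact acceptedNum_le X

lemma acceptedNum_insert_le (X : Sample n K N) (p : Fin n × Fin K) :
    acceptedNum L (insert p S) j X ≤ acceptedNum L S j X + if p.2 = j then 1 else 0 := by
  have := card_acceptedOf_insert_le (L := L) (t := Prod.snd) (g := univOf X) (B := strictOrder X)
    (S := S) (p := p) (j := j)
  unfold acceptedNum
  split_ifs at this ⊢ <;> exact_mod_cast this

lemma acceptedNum_le_insert (X : Sample n K N) (p : Fin n × Fin K) :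
    acceptedNum L S j X ≤ acceptedNum L (insert p S) j X + 1 := by
  have := card_acceptedOf_le_insert (L := L) (t := Prod.snd) (g := univOf X) (B := strictOrder X)
    (S := S) (p := p) (j := j)
  unfold acceptedNum
  exact_mod_cast this

lemma acceptedNum_union_le (X : Sample n K N) (R : Finset (Fin n × Fin K)) :
    acceptedNum L (S ∪ R) j X ≤ acceptedNum L S j X + (R.filter fun p => p.2 = j).card := by
  induction R using Finset.induction_on with
  | empty => simp
  | insert p R hp ih =>
    rw [Finset.union_insert, Finset.filter_insert]
    refine (acceptedNum_insert_le X p).trans ?_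
    split_ifs with h
    · rw [Finset.card_insert_of_notMem (by simp [hp])]; push_cast; linarith
    · linarith

lemma acceptedNum_le_union (X : Sample n K N) (R : Finset (Fin n × Fin K)) :
    acceptedNum L S j X ≤ acceptedNum L (S ∪ R) j X + R.card := by
  induction R using Finset.induction_on with
  | empty => simp
  | insert p R hp ih =>
    rw [Finset.union_insert, Finset.card_insert_of_notMem hp]
    have := acceptedNum_le_insert (L := L) (S := S ∪ R) (j := j) X p
    push_cast; linarith

lemma abs_acceptedNum_sub_le (X : Sample n K N) (h : S ⊆ S') :
    |acceptedNum L S' j X - acceptedNum L S j X| ≤ (S' \ S).card := by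
  have h1 := acceptedNum_union_le (L := L) (S := S) (j := j) X (S' \ S)
  have h2 := acceptedNum_le_union (L := L) (S := S) (j := j) X (S' \ S)
  have h3 : (((S' \ S).filter fun p => p.2 = j).card : ℝ) ≤ (S' \ S).card := by
    exact_mod_cast Finset.card_filter_le _ _
  rw [Finset.union_sdiff_of_subset h] at h1 h2
  rw [abs_le]; constructor <;> linarith

lemma abs_acceptedNum_sub_insert_le (X : Sample n K N) (p : Fin n × Fin K) :
    |acceptedNum L (insert p S) j X - acceptedNum L S j X| ≤ 1 := by
  have h1 := acceptedNum_insert_le (L := L) (S := S) (j := j) X p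
  have h2 := acceptedNum_le_insert (L := L) (S := S) (j := j) X p
  have h3 : (if p.2 = j then (1 : ℝ) else 0) ≤ 1 := by split_ifs <;> norm_num
  rw [abs_le]; constructor <;> linarith

/-- Remove `p` and put it back: without `p` the two samples agree, and each insertion changes the
count by at most 1. -/
lemma abs_acceptedNum_sub_le_two {X Y : Sample n K N} {p : Fin n × Fin K}
    (h : ∀ q, q ≠ p → X q = Y q) : |acceptedNum L S j X - acceptedNum L S j Y| ≤ 2 := by
  have h0 : acceptedNum L (S.erase p) j X = acceptedNum L (S.erase p) j Y := by
    unfold acceptedNum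
    rw [acceptedOf_congr (g' := univOf Y) (B' := strictOrder Y)]
    · intro x hx y hy
      simp only [univOf, h x (Finset.ne_of_mem_erase hx), h y (Finset.ne_of_mem_erase hy)]
    · intro x hx y hy
      simp only [strictOrder, h x (Finset.ne_of_mem_erase hx), h y (Finset.ne_of_mem_erase hy)]
  by_cases hp : p ∈ S
  · have h1 := abs_acceptedNum_sub_insert_le (L := L) (S := S.erase p) (j := j) X p
    have h2 := abs_acceptedNum_sub_insert_le (L := L) (S := S.erase p) (j := j) Y p
    rw [Finset.insert_erase hp] at h1 h2
    rw [h0] at h1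
    rw [abs_le] at *
    constructor <;> linarith
  · rw [Finset.erase_eq_of_notMem hp] at h0
    rw [h0]; simp

/-- The total number of accepted proposals. -/
lemma sum_acceptedNum (X : Sample n K N) :
    ∑ j, acceptedNum L S j X = ((accepted L (univOf X) (strictOrder X) S).card : ℝ) := by
  unfold acceptedNum
  rw [← Nat.cast_sum]
  congr 1
  rw [Finset.card_eq_sum_card_fiberwise (f := Prod.snd) (t := Finset.univ)
    fun _ _ => Finset.mem_coe.2 (Finset.mem_univ _)]
  refine Finset.sum_congr rfl fun j _ => ?_
  congr 1
  ext p
  rw [mem_acceptedOf, Finset.mem_filter]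

/-- The samples in which `p` goes to a university without proposals from `S`. -/
def vacant (S : Finset (Fin n × Fin K)) (p : Fin n × Fin K) : Set (Sample n K N) :=
  {X | ∀ q ∈ S, univOf X q ≠ univOf X p}

lemma measurableSet_vacant (p : Fin n × Fin K) : MeasurableSet (vacant (N := N) S p) :=
  measurableSet_setOfPred.2 (measurable_of_pattern fun g _ => ∀ q ∈ S, g q ≠ g p)

lemma sum_acceptedNum_insert (hL : 0 < L) {p : Fin n × Fin K} (hp : p ∉ S) (X : Sample n K N) :
    ∑ j, acceptedNum L S j X + (vacant S p).indicator (fun _ => (1 : ℝ)) X ≤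
      ∑ j, acceptedNum L (insert p S) j X := by
  rw [sum_acceptedNum, sum_acceptedNum]
  by_cases hv : X ∈ vacant S p
  · rw [Set.indicator_of_mem hv, accepted_insert_of_vacant hL hv,
      Finset.card_insert_of_notMem fun h => hp (accepted_subset h)]
    push_cast; exact le_rfl
  · rw [Set.indicator_of_notMem hv, add_zero]
    exact_mod_cast card_accepted_le_insert hp

variable (D D' : Measure ℝ) [IsProbabilityMeasure D] [IsProbabilityMeasure D']

lemma univLaw_real [NeZero N] (s : Set (Fin N)) :
    (univLaw N).real s = s.ncard / N := by
  rw [univLaw, measureReal_def, uniformOn_univ, ENNReal.toReal_div]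
  rw [Measure.count_apply_finite s s.toFinite, ← Set.ncard_eq_toFinset_card s]
  simp

/-- Split according to the university `u` of `p`. That `p` goes to `u` and all of `S` avoids `u` has
probability at least 1/N times the power of 1 - 1/N, and these N events are disjoint. -/
lemma le_sampleLaw_vacant [NeZero N] {p : Fin n × Fin K} (hp : p ∉ S) :
    (1 - 1 / (N : ℝ)) ^ (n * K) ≤ (sampleLaw D D' n K N).real (vacant S p) := by
  classical
  have hN : (1 : ℝ) ≤ N := by exact_mod_cast NeZero.one_le
  have hN' : (0 : ℝ) ≤ 1 - 1 / (N : ℝ) := by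
    rw [sub_nonneg, div_le_one (by linarith)]; exact hN
  have hN'' : 1 - 1 / (N : ℝ) ≤ 1 := by
    have : 0 ≤ 1 / (N : ℝ) := by positivity
    linarith
  let s : Fin N → Fin n × Fin K → Set (Fin N) := fun u q =>
    if q = p then {u} else if q ∈ S then {u}ᶜ else Set.univ
  let R : Fin N → Set (Sample n K N) := fun u => Set.univ.pi fun q => s u q ×ˢ Set.univ
  have hR : ⋃ u, R u ⊆ vacant S p := by
    intro X hX q hq
    obtain ⟨u, hu⟩ := Set.mem_iUnion.1 hX
    have h1 := (hu p trivial).1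
    have h2 := (hu q trivial).1
    have hqp : q ≠ p := fun h => hp (h ▸ hq)
    simp only [s, if_pos, Set.mem_singleton_iff] at h1
    simp only [s, if_neg hqp, if_pos hq, Set.mem_compl_iff, Set.mem_singleton_iff] at h2
    simp only [univOf, h1]
    exact h2
  have hmeas : ∀ u, MeasurableSet (R u) := fun u =>
    MeasurableSet.univ_pi fun q => (Set.toFinite _).measurableSet.prod MeasurableSet.univ
  have hval : ∀ u, 1 / (N : ℝ) * (1 - 1 / (N : ℝ)) ^ (n * K) ≤
      (sampleLaw D D' n K N).real (R u) := by
    intro u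
    have h1 : (sampleLaw D D' n K N).real (R u) = ∏ q, (univLaw N).real (s u q) := by
      simp only [measureReal_def, sampleLaw, R, Measure.pi_pi, Measure.prod_prod, measure_univ,
        mul_one, ENNReal.toReal_prod]
    rw [h1, ← Finset.mul_prod_erase _ _ (Finset.mem_univ p)]
    have h2 : (univLaw N).real (s u p) = 1 / N := by
      simp [s, univLaw_real]
    rw [h2]
    refine mul_le_mul_of_nonneg_left ?_ (by positivity)
    calc (1 - 1 / (N : ℝ)) ^ (n * K)
        ≤ (1 - 1 / (N : ℝ)) ^ (Finset.univ.erase p).card := by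
          apply pow_le_pow_of_le_one hN' hN''
          refine (Finset.card_le_univ _).trans ?_
          simp
      _ = ∏ q ∈ Finset.univ.erase p, (1 - 1 / (N : ℝ)) := by rw [Finset.prod_const]
      _ ≤ _ := by
          refine Finset.prod_le_prod (fun _ _ => hN') fun q hq => ?_
          simp only [s, if_neg (Finset.ne_of_mem_erase hq)]
          split_ifs
          · rw [univLaw_real, Set.ncard_compl, Nat.card_fin, Set.ncard_singleton,
              Nat.cast_sub NeZero.one_le, sub_div, div_self (by positivity)]
            simp
          · rw [univLaw_real, Set.ncard_univ, Nat.card_fin, div_self (by positivity)]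
            exact hN''
  have hsum : (sampleLaw D D' n K N).real (⋃ u, R u) =
      ∑ u, (sampleLaw D D' n K N).real (R u) := by
    rw [measureReal_iUnion_fintype]
    · intro u v huv
      rw [Function.onFun, Set.disjoint_left]
      intro X hu hv
      have h1 := (hu p trivial).1
      have h2 := (hv p trivial).1
      simp only [s, if_pos, Set.mem_singleton_iff] at h1 h2
      exact huv (h1.symm.trans h2)
    · exact hmeas
  calc (1 - 1 / (N : ℝ)) ^ (n * K)
      = ∑ _u : Fin N, 1 / (N : ℝ) * (1 - 1 / (N : ℝ)) ^ (n * K) := by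
        rw [Finset.sum_const, Finset.card_univ, Fintype.card_fin, nsmul_eq_mul]
        field_simp
    _ ≤ ∑ u, (sampleLaw D D' n K N).real (R u) := Finset.sum_le_sum fun u _ => hval u
    _ = (sampleLaw D D' n K N).real (⋃ u, R u) := hsum.symm
    _ ≤ _ := measureReal_mono hR

lemma integrable_acceptedNum [NeZero N] :
    Integrable (acceptedNum L S j) (sampleLaw D D' n K N) :=
  integrable_of_abs_le measurable_acceptedNum abs_acceptedNum_le

lemma abs_meanAccepted_sub_le [NeZero N] (h : S ⊆ S') :
    |meanAccepted D D' N L S' j - meanAccepted D D' N L S j| ≤ (S' \ S).card := by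
  unfold meanAccepted
  rw [← integral_sub (integrable_acceptedNum D D') (integrable_acceptedNum D D')]
  have := norm_integral_le_of_norm_le_const (μ := sampleLaw D D' n K N)
    (f := fun X => acceptedNum L S' j X - acceptedNum L S j X)
    (ae_of_all _ fun X => abs_acceptedNum_sub_le (L := L) (j := j) X h)
  simpa using this

/-- Additional competition never helps old proposals, so only new proposals of type `j` can raise
the count of type `j`. This gives the monotonicity in `meanOf_sub_le`. -/
lemma meanAccepted_le_add [NeZero N] (h : S ⊆ S') :
    meanAccepted D D' N L S' j ≤
      meanAccepted D D' N L S j + ((S' \ S).filter fun p => p.2 = j).card := by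
  unfold meanAccepted
  have h1 : ∀ X : Sample n K N, acceptedNum L S' j X ≤
      acceptedNum L S j X + (((S' \ S).filter fun p => p.2 = j).card : ℝ) := by
    intro X
    have := acceptedNum_union_le (L := L) (S := S) (j := j) X (S' \ S)
    rwa [Finset.union_sdiff_of_subset h] at this
  have h2 := integral_mono (μ := sampleLaw D D' n K N) (integrable_acceptedNum D D')
    ((integrable_acceptedNum D D').add (integrable_const _)) h1
  refine h2.trans (le_of_eq ?_)
  simp only [Pi.add_apply]
  rw [integral_add (integrable_acceptedNum D D') (integrable_const _)]
  simp

/-- The total never decreases when a proposal is added, and it gains 1 whenever that proposal meets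
an empty university. This linear growth is what makes the recursion stable. -/
lemma sum_meanAccepted_union [NeZero N] (hL : 0 < L) (R : Finset (Fin n × Fin K))
    (hR : Disjoint R S) :
    ∑ j, meanAccepted D D' N L S j + (1 - 1 / (N : ℝ)) ^ (n * K) * R.card ≤
      ∑ j, meanAccepted D D' N L (S ∪ R) j := by
  induction R using Finset.induction_on with
  | empty => simp
  | insert p R hp ih =>
    rw [Finset.disjoint_insert_left] at hR
    have hp' : p ∉ S ∪ R := by simp [hp, hR.1]
    rw [Finset.union_insert, Finset.card_insert_of_notMem hp]
    have h1 := ih hR.2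
    have hI : ∀ S : Finset (Fin n × Fin K),
        Integrable (fun X => ∑ j, acceptedNum L S j X) (sampleLaw D D' n K N) := fun S =>
      integrable_finsetSum _ fun j _ => integrable_acceptedNum D D'
    have hJ : Integrable ((vacant (S ∪ R) p).indicator fun _ => (1 : ℝ)) (sampleLaw D D' n K N) :=
      (integrable_const _).indicator (measurableSet_vacant p)
    have h2 := integral_mono (μ := sampleLaw D D' n K N) ((hI (S ∪ R)).add hJ)
      (hI (insert p (S ∪ R))) (sum_acceptedNum_insert hL hp')
    simp only [Pi.add_apply] at h2
    rw [integral_add (hI _) hJ, integral_finsetSum _ fun j _ => integrable_acceptedNum D D',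
      integral_finsetSum _ fun j _ => integrable_acceptedNum D D',
      integral_indicator (measurableSet_vacant p)] at h2
    simp only [integral_const, measureReal_restrict_apply_univ, smul_eq_mul, mul_one] at h2
    have h3 := le_sampleLaw_vacant D D' (N := N) hp'
    change ∑ j, meanAccepted D D' N L (S ∪ R) j + _ ≤
      ∑ j, meanAccepted D D' N L (insert p (S ∪ R)) j at h2
    push_cast
    nlinarith

lemma sum_meanAccepted_le [NeZero N] (hL : 0 < L) (h : S ⊆ S') :
    ∑ j, meanAccepted D D' N L S j + (1 - 1 / (N : ℝ)) ^ (n * K) * (S' \ S).card ≤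
      ∑ j, meanAccepted D D' N L S' j := by
  have := sum_meanAccepted_union D D' (N := N) hL (S' \ S) Finset.sdiff_disjoint
  rwa [Finset.union_sdiff_of_subset h] at this

lemma variance_acceptedNum_le [NeZero N] :
    Var[acceptedNum L S j; sampleLaw D D' n K N] ≤ 4 * (n * K) := by
  have := variance_pi_le (fun p : Fin n × Fin K => (univLaw N).prod (typeLaw D D' p.2))
    (measurable_acceptedNum (L := L) (S := S) (j := j)) abs_acceptedNum_le
    (fun p X Y h => abs_acceptedNum_sub_le_two h)
  refine this.trans (le_of_eq ?_)
  simp; ring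

end Counts

/-! ### Concentration of the number of accepted proposals -/

section Concentration

open ProbabilityTheory

variable {n K N L : ℕ}

lemma card_initialProposals_sdiff_filter {a b : Fin K → ℕ} (j : Fin K) (hb : b j ≤ n) :
    ((initialProposals n b \ initialProposals n a).filter fun p => p.2 = j).card = b j - a j := by
  rw [← Nat.card_Ico]
  refine Finset.card_bij (fun p _ => (p.1 : ℕ)) ?_ ?_ ?_
  · intro p hp
    rw [Finset.mem_filter, Finset.mem_sdiff, mem_initialProposals, mem_initialProposals] at hp
    obtain ⟨⟨h1, h2⟩, rfl⟩ := hp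
    rw [Finset.mem_Ico]; omega
  · intro p hp q hq hpq
    rw [Finset.mem_filter] at hp hq
    exact Prod.ext (Fin.ext hpq) (hp.2.trans hq.2.symm)
  · intro k hk
    rw [Finset.mem_Ico] at hk
    refine ⟨(⟨k, by omega⟩, j), ?_, rfl⟩
    rw [Finset.mem_filter, Finset.mem_sdiff, mem_initialProposals, mem_initialProposals]
    exact ⟨⟨hk.2, by simpa using hk.1⟩, rfl⟩

lemma card_initialProposals_sdiff {a b : Fin K → ℕ} (hb : ∀ j, b j ≤ n) :
    (initialProposals n b \ initialProposals n a).card = ∑ j, (b j - a j) := by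
  rw [Finset.card_eq_sum_card_fiberwise (f := Prod.snd) (t := Finset.univ)
    fun _ _ => Finset.mem_coe.2 (Finset.mem_univ _)]
  exact Finset.sum_congr rfl fun j _ => card_initialProposals_sdiff_filter j (hb j)

lemma initialProposals_mono {a b : Fin K → ℕ} (h : ∀ j, a j ≤ b j) :
    initialProposals n a ⊆ initialProposals n b := by
  intro p; simp only [mem_initialProposals]; exact fun hp => hp.trans_le (h _)

variable (D D' : Measure ℝ)

/-- The expected number of accepted proposals of type `j` among the first `a k` of each
type `k`. -/
def meanOf (D D' : Measure ℝ) (n N L : ℕ) {K : ℕ} (a : Fin K → ℕ) (j : Fin K) : ℝ :=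
  meanAccepted D D' N L (initialProposals n a) j

lemma meanOf_zero (a : Fin K → ℕ) (j : Fin K) : meanOf D D' n N 0 a j = 0 := by
  have : ∀ X : Sample n K N, acceptedNum 0 (initialProposals n a) j X = 0 := by
    intro X
    unfold acceptedNum
    rw [Nat.cast_eq_zero, Finset.card_eq_zero]
    ext p
    simp [mem_acceptedOf, mem_accepted]
  unfold meanOf meanAccepted
  simp [this]

/-- The samples with ties, or for which the number of accepted proposals is far from its mean at
some point of a grid. -/
def atypical (D D' : Measure ℝ) (n K N L m : ℕ) : Set (Sample n K N) :=
  tied n K N ∪ ⋃ z : (Fin K → Fin m) × Fin K,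
    {X | (n : ℝ) / m ≤ |acceptedNum L (initialProposals n fun k => (n / m + 1) * z.1 k) z.2 X -
      meanOf D D' n N L (fun k => (n / m + 1) * z.1 k) z.2|}

lemma measurableSet_atypical (m : ℕ) : MeasurableSet (atypical D D' n K N L m) :=
  measurableSet_tied.union <| MeasurableSet.iUnion fun _ =>
    measurableSet_le measurable_const ((measurable_acceptedNum.sub_const _).abs)

variable [IsProbabilityMeasure D] [IsProbabilityMeasure D']

/-- Ties are null. For the rest, Chebyshev with variance `4 * (n * K)` and deviation `n / m` is
summed over `m ^ K * K` pairs of a grid point and a type. -/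
lemma sampleLaw_atypical_le [NeZero N] {m : ℕ} (hm : 0 < m) (hn : 0 < n) :
    (sampleLaw D D' n K N).real (atypical D D' n K N L m) ≤ 4 * K ^ 2 * m ^ (K + 2) / n := by
  have hm' : (0 : ℝ) < m := by exact_mod_cast hm
  have hn' : (0 : ℝ) < n := by exact_mod_cast hn
  have hpos : (0 : ℝ) < n / m := by positivity
  unfold atypical
  refine (measureReal_union_le _ _).trans ?_
  have h0 : (sampleLaw D D' n K N).real (tied n K N) = 0 := by
    rw [measureReal_def, sampleLaw_tied]; rfl
  rw [h0, zero_add]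
  refine (measureReal_iUnion_fintype_le _).trans ?_
  calc ∑ z : (Fin K → Fin m) × Fin K, (sampleLaw D D' n K N).real
        {X | (n : ℝ) / m ≤ |acceptedNum L (initialProposals n fun k => (n / m + 1) * z.1 k) z.2 X -
          meanOf D D' n N L (fun k => (n / m + 1) * z.1 k) z.2|}
      ≤ ∑ _z : (Fin K → Fin m) × Fin K, 4 * (n * K) / ((n : ℝ) / m) ^ 2 := by
        refine Finset.sum_le_sum fun z _ => ?_
        have h1 := meas_ge_le_variance_div_sq (μ := sampleLaw D D' n K N)
          (memLp_two_of_abs_le (measurable_acceptedNum (L := L)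
            (S := initialProposals n fun k => (n / m + 1) * (z.1 k : ℕ)) (j := z.2))
            abs_acceptedNum_le) hpos
        refine (ENNReal.toReal_mono ENNReal.ofReal_ne_top h1).trans ?_
        rw [ENNReal.toReal_ofReal (div_nonneg (variance_nonneg _ _) (sq_nonneg _))]
        gcongr
        exact variance_acceptedNum_le D D'
    _ = 4 * K ^ 2 * m ^ (K + 2) / n := by
        rw [Finset.sum_const, Finset.card_univ, Fintype.card_prod, Fintype.card_fun]
        simp only [Fintype.card_fin, nsmul_eq_mul]
        push_cast
        field_simp
        ring

/-- For typical samples the numbers of accepted proposals are uniformly close to their means. -/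
lemma abs_acceptedNum_sub_meanOf_le [NeZero N] {m : ℕ} (hm : 0 < m) {X : Sample n K N}
    (hX : X ∉ atypical D D' n K N L m) {a : Fin K → ℕ} (ha : ∀ j, a j ≤ n) (j : Fin K) :
    |acceptedNum L (initialProposals n a) j X - meanOf D D' n N L a j| ≤
      n / m + 2 * K * (n / m + 1) := by
  have hm' : (0 : ℝ) < m := by exact_mod_cast hm
  -- The mesh of the grid. Since `h * m > n`, rounding any `a k ≤ n` down to a multiple of `h` lands
  -- on one of the `m` grid values.
  set h := n / m + 1 with hh
  have hpos : 0 < h := Nat.succ_pos _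
  have hlt : ∀ k, a k / h < m := by
    intro k
    rw [Nat.div_lt_iff_lt_mul hpos]
    refine (ha k).trans_lt ?_
    have := Nat.lt_div_mul_add (a := n) hm
    rw [hh]; nlinarith
  let b : Fin K → Fin m := fun k => ⟨a k / h, hlt k⟩
  let a' : Fin K → ℕ := fun k => h * (b k : ℕ)
  have hle : ∀ k, a' k ≤ a k := fun k => Nat.mul_div_le (a k) h
  have hsub := initialProposals_mono (n := n) hle
  have hcard : ((initialProposals n a \ initialProposals n a').card : ℝ) ≤ K * (n / m + 1) := by
    rw [card_initialProposals_sdiff ha, Nat.cast_sum]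
    have : ∀ k ∈ Finset.univ, ((a k - a' k : ℕ) : ℝ) ≤ n / m + 1 := by
      intro k _
      have h1 : a k - a' k ≤ h := by
        have := Nat.mod_add_div (a k) h
        have h2 := Nat.mod_lt (a k) hpos
        change a k - h * (a k / h) ≤ h
        omega
      calc ((a k - a' k : ℕ) : ℝ) ≤ h := by exact_mod_cast h1
        _ ≤ n / m + 1 := by
          rw [hh]; push_cast
          linarith [Nat.cast_div_le (α := ℝ) (m := n) (n := m)]
    refine (Finset.sum_le_sum this).trans (le_of_eq ?_)
    simp; ring
  have h1 := (abs_acceptedNum_sub_le (L := L) (j := j) X hsub).trans hcard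
  have h2 := (abs_meanAccepted_sub_le D D' (N := N) (L := L) (j := j) hsub).trans hcard
  have h3 : |acceptedNum L (initialProposals n a') j X - meanOf D D' n N L a' j| < n / m := by
    by_contra hc
    exact hX (Or.inr (Set.mem_iUnion.2 ⟨(b, j), not_lt.1 hc⟩))
  unfold meanOf at *
  rw [abs_le] at *
  rw [abs_lt] at h3
  constructor <;> linarith

/-- The rejections at the end of deferred acceptance. -/
def finalRejections (L : ℕ) (X : Sample n K N) : Fin n → ℕ :=
  rejections L (univOf X) (scoreOrder X) (n * K)

lemma proposers_le (r : Fin n → ℕ) (j : ℕ) : proposers r j ≤ n := by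
  unfold proposers
  exact (Finset.card_le_univ _).trans (by simp)

lemma proposers_zero (r : Fin n → ℕ) : proposers r 0 = n := by
  simp [proposers]

/-- The sample in which the proposals of each type are listed in the order in which they are
made. -/
def reorder (L : ℕ) (X : Sample n K N) : Sample n K N :=
  X ∘ (timeOrder L (univOf X) (scoreOrder X)).symm

/-- The reordered sample determines the permutation that produced it, hence can be sorted back. -/
lemma reorder_injective : Function.Injective (reorder L : Sample n K N → Sample n K N) := by
  intro X Y h
  have h1 : timeOrder L (univOf X) (scoreOrder X) = timeOrder L (univOf Y) (scoreOrder Y) := by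
    apply timeOrder_eq_of_reordered_eq
    · exact congrArg univOf h
    · exact congrArg scoreOrder h
  unfold reorder at h
  rw [h1] at h
  funext p
  simpa using congrFun h (timeOrder L (univOf Y) (scoreOrder Y) p)

/-- On the set where the time order is a given permutation, `reorder` is that permutation of
coordinates. It preserves the type, and the law of a coordinate depends only on its type, so it
preserves the measure. -/
lemma sampleLaw_reorder_preimage_le [NeZero N] {A : Set (Sample n K N)} (hA : MeasurableSet A) :
    sampleLaw D D' n K N (reorder L ⁻¹' A) ≤ sampleLaw D D' n K N A := by
  let Γ := {γ : Equiv.Perm (Fin n × Fin K) // ∀ p, (γ p).2 = p.2}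
  let ρ : Sample n K N → Γ := fun X =>
    ⟨timeOrder L (univOf X) (scoreOrder X), fun p => rfl⟩
  let T : Γ → Sample n K N ≃ᵐ Sample n K N := fun γ =>
    MeasurableEquiv.piCongrLeft (fun _ => Fin N × Score) γ.1
  have hT : ∀ X, T (ρ X) X = reorder L X := by
    intro X
    funext p
    obtain ⟨q, rfl⟩ := (ρ X).1.surjective p
    change MeasurableEquiv.piCongrLeft (fun _ => Fin N × Score) (ρ X).1 X ((ρ X).1 q) = _
    rw [MeasurableEquiv.coe_piCongrLeft, Equiv.piCongrLeft_apply_apply]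
    simp [reorder, ρ]
  have key := measure_preimage_le_of_piecewise (sampleLaw D D' n K N) ρ ?_ T ?_ ?_ hA
  · simpa only [hT] using key
  · intro γ
    have : ρ ⁻¹' {γ} = {X | timeOrder L (univOf X) (scoreOrder X) = γ.1} := by
      ext X; exact Subtype.ext_iff
    rw [this]
    exact measurableSet_setOfPred.2 (measurable_of_scorePattern fun g B => timeOrder L g B = γ.1)
  · intro γ
    have h := measurePreserving_piCongrLeft (α := fun _ : Fin n × Fin K => Fin N × Score)
      (fun p => (univLaw N).prod (typeLaw D D' p.2)) γ.1
    have h2 : (fun p => (univLaw N).prod (typeLaw D D' (γ.1 p).2)) =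
        fun p : Fin n × Fin K => (univLaw N).prod (typeLaw D D' p.2) := by
      funext p; rw [γ.2 p]
    rw [h2] at h
    exact h
  · simpa only [hT] using reorder_injective

/-- The recursion for the numbers of proposers, up to an error of `δ`. -/
structure ApproxSolution (D D' : Measure ℝ) (n K N L : ℕ) (δ : ℝ) (a : ℕ → ℕ) : Prop where
  zero : a 0 = n
  le : ∀ j, a j ≤ n
  succ : ∀ j : Fin K,
    |(a (j + 1) : ℝ) - (a j - meanOf D D' n N L (fun k : Fin K => a k) j)| ≤ δ

lemma approxSolution_of_reorder [NeZero N] {m : ℕ} (hm : 0 < m) {X : Sample n K N}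
    (hX : reorder L X ∉ atypical D D' n K N L m) :
    ApproxSolution D D' n K N L (n / m + 2 * K * (n / m + 1))
      (proposers (finalRejections L X)) where
  zero := proposers_zero _
  le := proposers_le _
  succ j := by
    have h1 := abs_acceptedNum_sub_meanOf_le D D' hm hX
      (a := fun k : Fin K => proposers (finalRejections L X) k) (fun k => proposers_le _ _) j
    have h2 := proposers_recursion L (univOf X) (scoreOrder X) j
    have h3 : (acceptedOf L Prod.snd
        (univOf X ∘ (timeOrder L (univOf X) (scoreOrder X)).symm)
        (fun p q => scoreOrder X ((timeOrder L (univOf X) (scoreOrder X)).symm p)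
          ((timeOrder L (univOf X) (scoreOrder X)).symm q))
        (initialProposals n fun k : Fin K => proposers (finalRejections L X) k) j).card =
        acceptedNum L (initialProposals n fun k : Fin K => proposers (finalRejections L X) k) j
          (reorder L X) := by
      unfold acceptedNum
      rw [strictOrder_eq_scoreOrder fun h => hX (Or.inl h)]
      rfl
    rw [← h3] at h1
    have h4 : (proposers (finalRejections L X) (j + 1) : ℝ) + ((acceptedOf L Prod.snd
        (univOf X ∘ (timeOrder L (univOf X) (scoreOrder X)).symm)
        (fun p q => scoreOrder X ((timeOrder L (univOf X) (scoreOrder X)).symm p)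
          ((timeOrder L (univOf X) (scoreOrder X)).symm q))
        (initialProposals n fun k : Fin K => proposers (finalRejections L X) k) j).card : ℕ) =
        proposers (finalRejections L X) j := by
      exact_mod_cast h2
    rw [abs_le] at *
    constructor <;> linarith

end Concentration

/-! ### Stability of the recursion -/

section Stability

variable {n K N L : ℕ} (D D' : Measure ℝ) [IsProbabilityMeasure D] [IsProbabilityMeasure D']

lemma meanOf_sub_le [NeZero N] {a b : Fin K → ℕ} (h : ∀ j, a j ≤ b j) (hb : ∀ j, b j ≤ n)
    (j : Fin K) : (a j : ℝ) - meanOf D D' n N L a j ≤ b j - meanOf D D' n N L b j := by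
  have h1 := meanAccepted_le_add D D' (N := N) (L := L) (j := j) (initialProposals_mono (n := n) h)
  rw [card_initialProposals_sdiff_filter j (hb j), Nat.cast_sub (h j)] at h1
  unfold meanOf
  linarith

lemma meanOf_lipschitz_of_le [NeZero N] {a b : Fin K → ℕ} (h : ∀ j, a j ≤ b j)
    (hb : ∀ j, b j ≤ n) (j : Fin K) :
    |meanOf D D' n N L b j - meanOf D D' n N L a j| ≤ ∑ k, ((b k : ℝ) - a k) := by
  have h1 := abs_meanAccepted_sub_le D D' (N := N) (L := L) (j := j)
    (initialProposals_mono (n := n) h)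
  rw [card_initialProposals_sdiff hb, Nat.cast_sum] at h1
  simpa only [meanOf, Nat.cast_sub (h _)] using h1

lemma meanOf_lipschitz [NeZero N] {a b : Fin K → ℕ} (ha : ∀ j, a j ≤ n) (hb : ∀ j, b j ≤ n)
    (j : Fin K) :
    |meanOf D D' n N L b j - meanOf D D' n N L a j| ≤ ∑ k, |(b k : ℝ) - a k| := by
  have h1 := meanOf_lipschitz_of_le D D' (N := N) (L := L) (a := a) (b := fun k => max (a k) (b k))
    (fun k => le_max_left _ _) (fun k => max_le (ha k) (hb k)) j
  have h2 := meanOf_lipschitz_of_le D D' (N := N) (L := L) (a := b) (b := fun k => max (a k) (b k))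
    (fun k => le_max_right _ _) (fun k => max_le (ha k) (hb k)) j
  have h3 : ∑ k, |(b k : ℝ) - a k| = ∑ k, (((max (a k) (b k) : ℕ) : ℝ) - a k) +
      ∑ k, (((max (a k) (b k) : ℕ) : ℝ) - b k) := by
    rw [← Finset.sum_add_distrib]
    refine Finset.sum_congr rfl fun k _ => ?_
    rcases le_total (a k) (b k) with h | h
    · rw [max_eq_right h, abs_of_nonneg (by simpa using h)]; ring
    · rw [max_eq_left h, abs_of_nonpos (by simpa using h)]; ring
  rw [h3]
  rw [abs_le] at *
  constructor <;> linarith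

variable {D D'}

lemma ApproxSolution.sub_le [NeZero N] (hL : 0 < L) {δ : ℝ} {a b : ℕ → ℕ}
    (ha : ApproxSolution D D' n K N L δ a) (hb : ApproxSolution D D' n K N L δ b) :
    (1 - 1 / (N : ℝ)) ^ (n * K) * ∑ j : Fin K, (((max (a j) (b j) : ℕ) : ℝ) - a j) ≤
      2 * K * δ := by
  set z : ℕ → ℕ := fun j => max (a j) (b j) with hz
  have hzn : ∀ j, z j ≤ n := fun j => max_le (ha.le j) (hb.le j)
  have h1 := sum_meanAccepted_le D D' (N := N) hL
    (initialProposals_mono (n := n) (a := fun j : Fin K => a j) (b := fun j : Fin K => z j)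
      fun j => le_max_left _ _)
  rw [card_initialProposals_sdiff fun j => hzn j, Nat.cast_sum] at h1
  have e1 : ∀ j : Fin K, ((z j - a j : ℕ) : ℝ) = (z j : ℝ) - a j := fun j =>
    Nat.cast_sub (le_max_left _ _)
  simp only [e1] at h1
  -- By monotonicity, both `a (j + 1)` and `b (j + 1)` are at most `z j` minus the mean at `z`, plus
  -- `δ`; so is their maximum.
  have h2 : ∀ j : Fin K, meanOf D D' n N L (fun k : Fin K => z k) j ≤
      ((z j : ℝ) - z (j + 1)) + δ := by
    intro j
    have ma := meanOf_sub_le D D' (N := N) (L := L) (a := fun k : Fin K => a k)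
      (b := fun k : Fin K => z k) (fun k => le_max_left _ _) (fun k => hzn k) j
    have mb := meanOf_sub_le D D' (N := N) (L := L) (a := fun k : Fin K => b k)
      (b := fun k : Fin K => z k) (fun k => le_max_right _ _) (fun k => hzn k) j
    have sa := (abs_le.1 (ha.succ j)).2
    have sb := (abs_le.1 (hb.succ j)).2
    have : (z (j + 1) : ℝ) = max (a (j + 1) : ℝ) (b (j + 1)) := by simp [hz]
    rw [this]
    rcases max_choice (a (j + 1) : ℝ) (b (j + 1)) with h | h <;> rw [h] <;> linarith
  have h3 : ∀ j : Fin K, ((a j : ℝ) - a (j + 1)) - δ ≤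
      meanOf D D' n N L (fun k : Fin K => a k) j := by
    intro j
    have sa := (abs_le.1 (ha.succ j)).1
    linarith
  have t : ∀ c : ℕ → ℕ, ∑ j : Fin K, ((c j : ℝ) - c (j + 1)) = c 0 - c K := by
    intro c
    rw [Fin.sum_univ_eq_sum_range (fun j => (c j : ℝ) - c (j + 1)),
      Finset.sum_range_sub' (fun j => (c j : ℝ))]
  have s2 := Finset.sum_le_sum fun j (_ : j ∈ Finset.univ) => h2 j
  have s3 := Finset.sum_le_sum fun j (_ : j ∈ Finset.univ) => h3 j
  rw [Finset.sum_add_distrib, t z] at s2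
  rw [Finset.sum_sub_distrib, t a] at s3
  simp only [Finset.sum_const, Finset.card_univ, Fintype.card_fin, nsmul_eq_mul] at s2 s3
  have z0 : (z 0 : ℝ) = a 0 := by simp [hz, ha.zero, hb.zero]
  have zK : (a K : ℝ) ≤ z K := by exact_mod_cast le_max_left _ _
  unfold meanOf at s2 s3
  linarith

/-- Two approximate solutions of the recursion are close. -/
lemma ApproxSolution.abs_sub_le [NeZero N] {δ c : ℝ} (hδ : 0 ≤ δ) (hc : 0 < c) (hc1 : c ≤ 1)
    (hcN : c ≤ (1 - 1 / (N : ℝ)) ^ (n * K)) {a b : ℕ → ℕ}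
    (ha : ApproxSolution D D' n K N L δ a) (hb : ApproxSolution D D' n K N L δ b) (j : Fin K) :
    |(a j : ℝ) - b j| ≤ 4 * K * δ / c := by
  rcases Nat.eq_zero_or_pos L with rfl | hL
  -- For `L = 0` nothing is ever accepted and the growth of the total fails. But the recursion then
  -- keeps every solution within `K * δ` of the constant `n`.
  · have key : ∀ a : ℕ → ℕ, ApproxSolution D D' n K N 0 δ a → ∀ j ≤ K, |(a j : ℝ) - n| ≤ j * δ := by
      intro a ha j
      induction j with
      | zero => intro _; simp [ha.zero]
      | succ j ih =>
        intro hj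
        have h1 := ih (by omega)
        have h2 := ha.succ ⟨j, hj⟩
        rw [meanOf_zero] at h2
        simp only [abs_le] at *
        push_cast
        constructor <;> linarith
    have h1 := key a ha j j.2.le
    have h2 := key b hb j j.2.le
    have hjK : (j : ℝ) * δ ≤ K * δ := by
      gcongr; exact_mod_cast j.2.le
    have hK : 0 ≤ K * δ := by positivity
    have h3 : 4 * K * δ ≤ 4 * K * δ / c := by
      rw [le_div_iff₀ hc]; nlinarith
    rw [abs_le] at *
    constructor <;> linarith
  · have h1 := ha.sub_le hL hb
    have h2 := hb.sub_le hL ha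
    have aux : ∀ a b : ℕ → ℕ, (1 - 1 / (N : ℝ)) ^ (n * K) *
        ∑ j : Fin K, (((max (a j) (b j) : ℕ) : ℝ) - a j) ≤ 2 * K * δ →
        ((max (a j) (b j) : ℕ) : ℝ) - a j ≤ 2 * K * δ / c := by
      intro a b h
      have hnn : ∀ j : Fin K, 0 ≤ ((max (a j) (b j) : ℕ) : ℝ) - a j := fun j => by
        rw [sub_nonneg]; exact_mod_cast le_max_left _ _
      rw [le_div_iff₀ hc]
      have h4 := Finset.single_le_sum (fun j _ => hnn j) (Finset.mem_univ j)
      calc (((max (a j) (b j) : ℕ) : ℝ) - a j) * c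
          ≤ (∑ j : Fin K, (((max (a j) (b j) : ℕ) : ℝ) - a j)) * (1 - 1 / (N : ℝ)) ^ (n * K) := by
            apply mul_le_mul h4 hcN hc.le
            exact Finset.sum_nonneg fun j _ => hnn j
        _ ≤ 2 * K * δ := by rw [mul_comm]; exact h
    have h3 := aux a b h1
    have h4 := aux b a h2
    rw [max_comm] at h4
    have h5 : (a j : ℝ) ≤ (max (a j) (b j) : ℕ) := by exact_mod_cast le_max_left _ _
    have h6 : (b j : ℝ) ≤ (max (a j) (b j) : ℕ) := by exact_mod_cast le_max_right _ _
    have h7 : 4 * K * δ / c = 2 * K * δ / c + 2 * K * δ / c := by ring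
    have h8 : 0 ≤ 2 * K * δ / c := by positivity
    rw [h7, abs_le]
    constructor <;> linarith

end Stability

/-! ### Averages over universities and integrals over scores -/

section Average

open ProbabilityTheory

lemma integral_pi_univLaw {ι : Type*} [Fintype ι] [DecidableEq ι] {N : ℕ} [NeZero N]
    (h : (ι → Fin N) → ℝ) :
    ∫ g, h g ∂(Measure.pi fun _ : ι => univLaw N) = (∑ g, h g) / Fintype.card (ι → Fin N) := by
  have h1 : (Measure.pi fun _ : ι => univLaw N) = uniformOn Set.univ := by
    rw [← Set.pi_univ Set.univ, uniformOn_pi]; rfl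
  have h2 : IsProbabilityMeasure (uniformOn (Set.univ : Set (ι → Fin N))) :=
    isProbabilityMeasure_uniformOn Set.finite_univ Set.univ_nonempty
  rw [h1, integral_fintype (.of_finite), Finset.sum_div]
  refine Finset.sum_congr rfl fun g _ => ?_
  rw [measureReal_def, uniformOn_univ]
  simp [div_eq_inv_mul]

/-- Integration over independent proposals to uniformly random universities. -/
lemma integral_pi_univLaw_prod {ι : Type*} [Fintype ι] [DecidableEq ι] {N : ℕ} [NeZero N]
    (ν : ι → Measure Score) [∀ i, IsProbabilityMeasure (ν i)] {φ : (ι → Fin N × Score) → ℝ}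
    (hφ : Measurable φ) {C : ℝ} (hC : ∀ X, |φ X| ≤ C) :
    ∫ X, φ X ∂(Measure.pi fun i => (univLaw N).prod (ν i)) =
      (∑ g : ι → Fin N, ∫ τ, φ (fun i => (g i, τ i)) ∂(Measure.pi ν)) /
        Fintype.card (ι → Fin N) := by
  have e := (measurePreserving_arrowProdEquivProdArrow (Fin N) Score ι (fun _ => univLaw N) ν).symm
  rw [← e.integral_comp', integral_prod]
  · exact integral_pi_univLaw fun g => ∫ τ, φ (fun i => (g i, τ i)) ∂(Measure.pi ν)
  · exact integrable_of_abs_le (hφ.comp e.measurable) fun z => hC _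

end Average

/-! ### Comparison of random lists with independent choices -/

section Lists

variable {n K N L : ℕ}

/-- The proposals that the students can make, for given lists and scores. -/
def sampleOf (h : K ≤ N) (π : Prefs n N) (σ : Fin n × Fin N → Score) : Sample n K N := fun p =>
  (π p.1 (Fin.castLE h p.2), σ (p.1, π p.1 (Fin.castLE h p.2)))

lemma target_eq_some_iff (h : K ≤ N) {π : Prefs n N} {r : Fin n → ℕ} {s : Fin n} {u : Fin N} :
    target K π r s = some u ↔ ∃ j : Fin K, (j : ℕ) = r s ∧ π s (Fin.castLE h j) = u := by
  unfold target
  constructor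
  · intro ht
    split_ifs at ht with hr
    exact ⟨⟨r s, hr.2⟩, rfl, Option.some.inj ht⟩
  · rintro ⟨j, hj, rfl⟩
    have hr : r s < N ∧ r s < K := by have := j.2; omega
    rw [dif_pos hr]
    congr 2
    exact Fin.ext hj.symm

lemma rejected_iff (h : K ≤ N) (π : Prefs n N) (σ : Fin n × Fin N → Score) (r : Fin n → ℕ)
    (s : Fin n) : Rejected K L π σ r s ↔ ∃ p ∈ pending K r, p.1 = s ∧
      p ∉ accepted L (univOf (sampleOf h π σ)) (scoreOrder (sampleOf h π σ)) (pending K r) := by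
  have key : ∀ p ∈ pending K r,
      {s' : Fin n | target K π r s' = some (π p.1 (Fin.castLE h p.2)) ∧
        Beats (σ (s', π p.1 (Fin.castLE h p.2))) (σ (p.1, π p.1 (Fin.castLE h p.2)))}.ncard =
      (rivals (univOf (sampleOf h π σ)) (scoreOrder (sampleOf h π σ)) (pending K r) p).card := by
    intro p _
    rw [← Finset.card_image_of_injOn (f := Prod.fst), ← Set.ncard_coe_finset]
    · congr 1
      ext s'
      simp only [Set.mem_ofPred_eq, Finset.coe_image, Set.mem_image, Finset.mem_coe, mem_rivals,
        mem_pending, univOf, scoreOrder, sampleOf, target_eq_some_iff h]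
      constructor
      · rintro ⟨⟨j, hj, hu⟩, hB⟩
        exact ⟨(s', j), ⟨hj, hu, by rw [hu]; exact hB⟩, rfl⟩
      · rintro ⟨q, ⟨hq, hu, hB⟩, rfl⟩
        exact ⟨⟨q.2, hq, hu⟩, by rw [hu] at hB; exact hB⟩
    · intro q hq q' hq' hqq
      have h1 := mem_pending.1 (mem_rivals.1 hq).1
      have h2 := mem_pending.1 (mem_rivals.1 hq').1
      refine Prod.ext hqq (Fin.ext ?_)
      rw [h1, h2]; exact congrArg r hqq
  constructor
  · rintro ⟨u, hu, hL⟩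
    obtain ⟨j, hj, rfl⟩ := (target_eq_some_iff h).1 hu
    have hp : (s, j) ∈ pending K r := mem_pending.2 hj
    refine ⟨(s, j), hp, rfl, fun hacc => ?_⟩
    have := (mem_accepted.1 hacc).2
    rw [← key _ hp] at this
    exact absurd hL (not_le.2 this)
  · rintro ⟨p, hp, rfl, hacc⟩
    refine ⟨_, (target_eq_some_iff h).2 ⟨p.2, mem_pending.1 hp, rfl⟩, ?_⟩
    rw [key p hp]
    by_contra hlt
    exact hacc (mem_accepted.2 ⟨hp, not_le.1 hlt⟩)

lemma daRejections_eq (h : K ≤ N) (π : Prefs n N) (σ : Fin n × Fin N → Score) :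
    daRejections K L π σ = finalRejections L (sampleOf h π σ) := by
  have : daStep K L π σ =
      rejectStep L (univOf (sampleOf h π σ)) (scoreOrder (sampleOf h π σ)) := by
    funext r s
    unfold daStep rejectStep
    simp only [rejected_iff h]
  unfold daRejections finalRejections rejections
  rw [this]

lemma proposerCount_eq (h : K ≤ N) (π : Prefs n N) (σ : Fin n × Fin N → Score) {j : ℕ}
    (hj : j < K) : proposerCount K L π σ (j + 1) =
      proposers (finalRejections L (sampleOf h π σ)) j := by
  unfold proposerCount proposers
  rw [daRejections_eq h, ← Set.ncard_coe_finset]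
  congr 1
  ext s
  have h1 : j + 1 ≤ K := hj
  have h2 : j + 1 ≤ N := hj.trans_le h
  simp [h1, h2]

variable (D D' : Measure ℝ) [IsProbabilityMeasure D] [IsProbabilityMeasure D']

/-- The first `K` universities of a list are distinct, so their scores are distinct independent
coordinates; position 0 is the favorite and gets `D`. -/
lemma map_signalLaw (h : K ≤ N) (π : Prefs n N) :
    (signalLaw D D' π).map (fun σ (p : Fin n × Fin K) => σ (p.1, π p.1 (Fin.castLE h p.2))) =
      Measure.pi fun p : Fin n × Fin K => typeLaw D D' p.2 := by
  have hinst : ∀ p : Fin n × Fin N, IsProbabilityMeasure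
      (if ((π p.1).symm p.2 : ℕ) = 0 then scoreLaw D else scoreLaw D') := by
    intro p; split_ifs <;> infer_instance
  have := map_comp_pi (fun p : Fin n × Fin N =>
    if ((π p.1).symm p.2 : ℕ) = 0 then scoreLaw D else scoreLaw D')
    (e := fun p : Fin n × Fin K => (p.1, π p.1 (Fin.castLE h p.2))) (by
      rintro ⟨s, j⟩ ⟨s', j'⟩ hp
      simp only [Prod.mk.injEq] at hp
      obtain ⟨rfl, hp⟩ := hp
      have := (π s).injective hp
      exact Prod.ext rfl (Fin.castLE_injective h this))
  refine Eq.trans this ?_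
  congr 1
  funext p
  simp [typeLaw]

/-- Two permutations with the same first `K` values differ by a permutation that fixes those
positions. -/
lemma card_perm_extending_le (h : K ≤ N) (v : Fin K → Fin N) :
    (Finset.univ.filter fun ρ : Equiv.Perm (Fin N) => ∀ j, ρ (Fin.castLE h j) = v j).card ≤
      (N - K).factorial := by
  rcases Finset.eq_empty_or_nonempty
    (Finset.univ.filter fun ρ : Equiv.Perm (Fin N) => ∀ j, ρ (Fin.castLE h j) = v j) with he | he
  · rw [he]; simp
  obtain ⟨ρ₀, h₀⟩ := he
  rw [Finset.mem_filter] at h₀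
  have hcard : Fintype.card {x : Fin N // ¬ (x : ℕ) < K} = N - K := by
    rw [Fintype.card_subtype_compl]
    have : Fintype.card {x : Fin N // (x : ℕ) < K} = K := by
      rw [Fintype.card_congr (Fin.castLEquiv h).symm]
      exact Fintype.card_fin K
    rw [this, Fintype.card_fin]
  rw [← hcard, ← Fintype.card_perm,
    Fintype.card_congr (Equiv.Perm.subtypeEquivSubtypePerm fun x : Fin N => ¬ (x : ℕ) < K),
    ← Fintype.card_coe]
  refine Fintype.card_le_of_injective (fun ρ => ⟨ρ₀⁻¹ * ρ.1, fun x hx => ?_⟩) ?_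
  · have h1 := (Finset.mem_filter.1 ρ.2).2 ⟨x, not_not.1 hx⟩
    have h2 := h₀.2 ⟨x, not_not.1 hx⟩
    have h3 : Fin.castLE h ⟨x, not_not.1 hx⟩ = x := rfl
    rw [h3] at h1 h2
    rw [Equiv.Perm.mul_apply, h1, ← h2]
    exact ρ₀.symm_apply_apply x
  · intro ρ ρ' hρ
    have := congrArg Subtype.val hρ
    exact Subtype.ext (mul_left_cancel this)

lemma card_prefs_extending_le (h : K ≤ N) (g : Fin n × Fin K → Fin N) :
    (Finset.univ.filter fun π : Prefs n N =>
      (fun p : Fin n × Fin K => π p.1 (Fin.castLE h p.2)) = g).card ≤ (N - K).factorial ^ n := by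
  have : (Finset.univ.filter fun π : Prefs n N =>
      (fun p : Fin n × Fin K => π p.1 (Fin.castLE h p.2)) = g) =
      Fintype.piFinset fun s => Finset.univ.filter fun ρ : Equiv.Perm (Fin N) =>
        ∀ j, ρ (Fin.castLE h j) = g (s, j) := by
    ext π
    simp [funext_iff, Fintype.mem_piFinset]
  rw [this, Fintype.card_piFinset]
  refine (Finset.prod_le_pow_card _ _ _ fun s _ => card_perm_extending_le h _).trans ?_
  simp

/-- Averages over random lists are controlled by averages over independent choices. -/
lemma average_prefs_le [NeZero N] (h : K < N) {φ : Sample n K N → ℝ} (hφ : Measurable φ)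
    {C : ℝ} (hC : ∀ X, |φ X| ≤ C) (hφ0 : ∀ X, 0 ≤ φ X) :
    (∑ π : Prefs n N, ∫ σ, φ (sampleOf h.le π σ) ∂(signalLaw D D' π)) /
        Fintype.card (Prefs n N) ≤
      ((N : ℝ) / (N - K)) ^ (n * K) * ∫ X, φ X ∂(sampleLaw D D' n K N) := by
  set H : (Fin n × Fin K → Fin N) → ℝ := fun g =>
    ∫ τ, φ (fun p => (g p, τ p)) ∂(Measure.pi fun p : Fin n × Fin K => typeLaw D D' p.2) with hH
  have hH0 : ∀ g, 0 ≤ H g := fun g => integral_nonneg fun τ => hφ0 _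
  have h1 : ∀ π : Prefs n N, ∫ σ, φ (sampleOf h.le π σ) ∂(signalLaw D D' π) =
      H fun p => π p.1 (Fin.castLE h.le p.2) := by
    intro π
    simp only [hH]
    rw [← map_signalLaw D D' h.le π, integral_map]
    · rfl
    · exact Measurable.aemeasurable (by fun_prop)
    · exact (hφ.comp (by fun_prop)).aestronglyMeasurable
  -- Group the lists by their first `K` entries. Choices with a repetition come from no list, so
  -- only an upper bound holds; this is why `φ` has to be nonnegative.
  have h2 : ∑ π : Prefs n N, H (fun p => π p.1 (Fin.castLE h.le p.2)) ≤
      ((N - K).factorial : ℝ) ^ n * ∑ g, H g := by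
    rw [← Finset.sum_fiberwise (g := fun (π : Prefs n N) (p : Fin n × Fin K) =>
      π p.1 (Fin.castLE h.le p.2)), Finset.mul_sum]
    refine Finset.sum_le_sum fun g _ => ?_
    rw [Finset.sum_congr rfl (g := fun _ => H g) fun π hπ => by
      rw [(Finset.mem_filter.1 hπ).2], Finset.sum_const, nsmul_eq_mul]
    refine mul_le_mul_of_nonneg_right ?_ (hH0 g)
    exact_mod_cast card_prefs_extending_le h.le g
  have h3 : ∫ X, φ X ∂(sampleLaw D D' n K N) = (∑ g, H g) / (N : ℝ) ^ (n * K) := by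
    have := integral_pi_univLaw_prod (fun p : Fin n × Fin K => typeLaw D D' p.2) hφ hC
    rw [sampleLaw, this]
    simp [hH]
  have hcard : (Fintype.card (Prefs n N) : ℝ) =
      ((N - K).factorial : ℝ) ^ n * (N.descFactorial K : ℝ) ^ n := by
    rw [← mul_pow]
    have := Nat.factorial_mul_descFactorial h.le
    rw [← Nat.cast_mul, this]
    simp [Fintype.card_perm]
  have hNK : (0 : ℝ) < (N : ℝ) - K := by
    rw [sub_pos]; exact_mod_cast h
  have hN : (0 : ℝ) < N := by exact_mod_cast NeZero.pos N
  have hdesc : ((N : ℝ) - K) ^ K ≤ N.descFactorial K := by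
    calc ((N : ℝ) - K) ^ K ≤ ((N + 1 - K : ℕ) : ℝ) ^ K := by
          apply pow_le_pow_left₀ hNK.le
          rw [Nat.cast_sub (by omega)]; push_cast; linarith
      _ ≤ _ := by exact_mod_cast Nat.pow_sub_le_descFactorial N K
  have hfac : (0 : ℝ) < (N - K).factorial := by exact_mod_cast Nat.factorial_pos _
  have hsum : 0 ≤ ∑ g, H g := Finset.sum_nonneg fun g _ => hH0 g
  simp only [h1]
  rw [h3, hcard]
  have hpow : (((N : ℝ) - K) ^ K) ^ n ≤ (N.descFactorial K : ℝ) ^ n :=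
    pow_le_pow_left₀ (by positivity) hdesc n
  calc (∑ π : Prefs n N, H fun p => π p.1 (Fin.castLE h.le p.2)) /
        (((N - K).factorial : ℝ) ^ n * (N.descFactorial K : ℝ) ^ n)
      ≤ ((N - K).factorial : ℝ) ^ n * (∑ g, H g) /
        (((N - K).factorial : ℝ) ^ n * (((N : ℝ) - K) ^ K) ^ n) := by
        gcongr
    _ = (∑ g, H g) / ((N : ℝ) - K) ^ (n * K) := by
        rw [mul_div_mul_left _ _ (by positivity), ← pow_mul, mul_comm K n]
    _ = ((N : ℝ) / (N - K)) ^ (n * K) * ((∑ g, H g) / (N : ℝ) ^ (n * K)) := by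
        rw [div_pow]; field_simp

end Lists

/-! ### Independent random proposals -/

section Proposals

variable {n K N L : ℕ}

/-- The numbers of proposals of each type. -/
def proposalNum (K n : ℕ) (x : ℕ → ℝ) (j : Fin K) : ℕ := ⌊x ((j : ℕ) + 1) * n⌋₊

/-- Proposals as the first indices of each type. -/
def proposalEmb {x : ℕ → ℝ} (hx : ∀ j : Fin K, proposalNum K n x j ≤ n) :
    Proposal K n x ↪ Fin n × Fin K where
  toFun p := (Fin.castLE (hx p.1) p.2, p.1)
  inj' := by
    rintro ⟨j, k⟩ ⟨j', k'⟩ h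
    simp only [Prod.mk.injEq] at h
    obtain ⟨h1, rfl⟩ := h
    congr 1
    exact Fin.castLE_injective _ h1

lemma map_proposalEmb {x : ℕ → ℝ} (hx : ∀ j : Fin K, proposalNum K n x j ≤ n) :
    Finset.univ.map (proposalEmb hx) = initialProposals n (proposalNum K n x) := by
  ext p
  simp only [Finset.mem_map, Finset.mem_univ, true_and, mem_initialProposals]
  constructor
  · rintro ⟨q, rfl⟩; exact q.2.2
  · intro h; exact ⟨⟨p.2, ⟨p.1, h⟩⟩, rfl⟩

lemma acceptedCount_eq {x : ℕ → ℝ} (X : Proposal K n x → Fin N × Score) (j : Fin K) :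
    acceptedCount L (fun p => (X p).1) (fun p => (X p).2) (j + 1) =
      (acceptedOf L Sigma.fst (univOf X) (scoreOrder X) Finset.univ j).card := by
  unfold acceptedCount
  rw [← Set.ncard_coe_finset]
  congr 1
  ext p
  simp only [Set.mem_ofPred_eq, Finset.mem_coe, mem_acceptedOf, mem_accepted, Finset.mem_univ,
    true_and]
  rw [and_comm, ← Set.ncard_coe_finset]
  refine and_congr (iff_of_eq ?_) ?_
  · congr 2
    ext q
    simp [mem_rivals, univOf, scoreOrder]
  · simp [Proposal.type, Fin.ext_iff]

variable (D D' : Measure ℝ) [IsProbabilityMeasure D] [IsProbabilityMeasure D']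

/-- Proposals of a given type are exchangeable, so the independent proposals can be taken to be the
initial ones of a full sample. This requires at most `n` proposals of each type. -/
lemma expectedAccepted_eq [NeZero N] {x : ℕ → ℝ} (hx : ∀ j : Fin K, proposalNum K n x j ≤ n)
    (j : Fin K) :
    expectedAccepted D D' K L n N x (j + 1) = meanOf D D' n N L (proposalNum K n x) j := by
  classical
  have hlaw : proposalLaw D D' K n x = Measure.pi fun p : Proposal K n x => typeLaw D D' p.1 := by
    unfold proposalLaw
    congr 1
    funext p
    simp [Proposal.type, typeLaw]
  let ψ : (Proposal K n x → Fin N × Score) → ℝ := fun X =>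
    ((acceptedOf L Sigma.fst (univOf X) (scoreOrder X) Finset.univ j).card : ℝ)
  have hψ : Measurable ψ := measurable_of_scorePattern fun g B =>
    ((acceptedOf L Sigma.fst g B Finset.univ j).card : ℝ)
  have hψC : ∀ X, |ψ X| ≤ Fintype.card (Proposal K n x) := by
    intro X
    rw [abs_of_nonneg (Nat.cast_nonneg _)]
    exact Nat.cast_le.2 (Finset.card_le_univ _)
  have h1 : expectedAccepted D D' K L n N x (j + 1) =
      ∫ X, ψ X ∂(Measure.pi fun p : Proposal K n x => (univLaw N).prod (typeLaw D D' p.1)) := by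
    rw [integral_pi_univLaw_prod _ hψ hψC, expectedAccepted, hlaw]
    congr 1
    · refine Finset.sum_congr rfl fun g _ => ?_
      congr 1
      funext τ
      exact congrArg Nat.cast (acceptedCount_eq (L := L) (fun p => (g p, τ p)) j)
  have h2 := map_comp_pi (fun p : Fin n × Fin K => (univLaw N).prod (typeLaw D D' p.2))
    (proposalEmb hx).injective
  change _ = Measure.pi fun p : Proposal K n x => (univLaw N).prod (typeLaw D D' p.1) at h2
  rw [h1, ← h2, integral_map (Measurable.aemeasurable (by fun_prop)) hψ.aestronglyMeasurable]
  unfold meanOf meanAccepted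
  refine integral_congr_ae ?_
  have hties : ∀ᵐ X ∂(sampleLaw D D' n K N), X ∉ tied n K N :=
    measure_eq_zero_iff_ae_notMem.1 (sampleLaw_tied D D')
  filter_upwards [hties] with X hX
  unfold acceptedNum
  rw [strictOrder_eq_scoreOrder hX, ← map_proposalEmb hx, acceptedOf_map, Finset.card_map]
  rfl

end Proposals

/-! ### The recursion for the expected numbers of proposers -/

section Recursion

variable {n K N L : ℕ} (D D' : Measure ℝ)

lemma measurable_proposers (j : ℕ) :
    Measurable fun X : Sample n K N => (proposers (finalRejections L X) j : ℝ) :=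
  measurable_of_scorePattern fun g B => (proposers (rejections L g B (n * K)) j : ℝ)

lemma measurable_sampleOf (h : K ≤ N) (π : Prefs n N) : Measurable (sampleOf h π) := by
  unfold sampleOf; fun_prop

lemma expectedProposers_eq (h : K ≤ N) {j : ℕ} (hj : j < K) :
    expectedProposers D D' K L n N (j + 1) =
      (∑ π : Prefs n N, ∫ σ, (proposers (finalRejections L (sampleOf h π σ)) j : ℝ)
        ∂(signalLaw D D' π)) / Fintype.card (Prefs n N) := by
  unfold expectedProposers
  simp only [proposerCount_eq h _ _ hj]

lemma expectedProposers_nonneg (i : ℕ) : 0 ≤ expectedProposers D D' K L n N i :=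
  div_nonneg (Finset.sum_nonneg fun _ _ => integral_nonneg fun _ => Nat.cast_nonneg _)
    (Nat.cast_nonneg _)

/-- The samples for which the numbers of proposers do not satisfy the recursion. -/
def unsolved (D D' : Measure ℝ) (n K N L : ℕ) (δ : ℝ) : Set (Sample n K N) :=
  {X | ¬ ApproxSolution D D' n K N L δ (proposers (finalRejections L X))}

lemma measurableSet_unsolved (δ : ℝ) : MeasurableSet (unsolved D D' n K N L δ) :=
  measurableSet_setOfPred.2 (measurable_of_scorePattern fun g B =>
    ¬ ApproxSolution D D' n K N L δ (proposers (rejections L g B (n * K))))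

variable [IsProbabilityMeasure D] [IsProbabilityMeasure D']

instance isProbabilityMeasure_signalLaw (π : Prefs n N) :
    IsProbabilityMeasure (signalLaw D D' π) := by
  have : ∀ p : Fin n × Fin N, IsProbabilityMeasure
      (if ((π p.1).symm p.2 : ℕ) = 0 then scoreLaw D else scoreLaw D') := by
    intro p; split_ifs <;> infer_instance
  unfold signalLaw; infer_instance

/-- The comparison of lists with samples is one-sided, so it is applied to the absolute deviation
from a constant rather than to the count. -/
lemma abs_expectedProposers_sub_le [NeZero N] (h : K < N) {j : ℕ} (hj : j < K) (a : ℝ) :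
    |expectedProposers D D' K L n N (j + 1) - a| ≤ ((N : ℝ) / (N - K)) ^ (n * K) *
      ∫ X, |(proposers (finalRejections L X) j : ℝ) - a| ∂(sampleLaw D D' n K N) := by
  have hb : ∀ X : Sample n K N, |(proposers (finalRejections L X) j : ℝ) - a| ≤ n + |a| := by
    intro X
    refine (abs_sub _ _).trans ?_
    rw [Nat.abs_cast]
    have : (proposers (finalRejections L X) j : ℝ) ≤ n := by exact_mod_cast proposers_le _ _
    linarith
  have hm : Measurable fun X : Sample n K N => |(proposers (finalRejections L X) j : ℝ) - a| :=
    ((measurable_proposers j).sub_const _).abs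
  refine le_trans ?_ (average_prefs_le D D' h hm (C := n + |a|) (fun X => by
    rw [abs_abs]; exact hb X) fun X => abs_nonneg _)
  have hcard : (0 : ℝ) < Fintype.card (Prefs n N) := by exact_mod_cast Fintype.card_pos
  rw [expectedProposers_eq D D' h.le hj, div_sub' hcard.ne', abs_div, abs_of_pos hcard]
  gcongr
  have h1 : ∀ π : Prefs n N, Integrable (fun σ =>
      (proposers (finalRejections L (sampleOf h.le π σ)) j : ℝ)) (signalLaw D D' π) := by
    intro π
    refine integrable_of_abs_le ((measurable_proposers j).comp (measurable_sampleOf h.le π))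
      (C := n) fun σ => ?_
    rw [Nat.abs_cast]
    exact_mod_cast proposers_le _ _
  have h2 : ∑ π : Prefs n N, ∫ σ, (proposers (finalRejections L (sampleOf h.le π σ)) j : ℝ)
      ∂(signalLaw D D' π) - Fintype.card (Prefs n N) * a =
      ∑ π : Prefs n N, ∫ σ, ((proposers (finalRejections L (sampleOf h.le π σ)) j : ℝ) - a)
      ∂(signalLaw D D' π) := by
    simp_rw [fun π => integral_sub (h1 π) (integrable_const a)]
    rw [Finset.sum_sub_distrib]
    simp
  rw [h2]
  refine (Finset.abs_sum_le_sum_abs _ _).trans (Finset.sum_le_sum fun π _ => ?_)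
  exact abs_integral_le_integral_abs

lemma expectedProposers_one [NeZero N] (h : K < N) (hK : 0 < K) :
    expectedProposers D D' K L n N 1 = n := by
  have := abs_expectedProposers_sub_le (n := n) (L := L) D D' h hK n
  simp only [proposers_zero, sub_self, abs_zero, integral_zero, mul_zero] at this
  exact sub_eq_zero.1 (abs_nonpos_iff.1 this)

lemma expectedProposers_le {j : ℕ} (h : K ≤ N) (hj : j < K) :
    expectedProposers D D' K L n N (j + 1) ≤ n := by
  have hcard : (0 : ℝ) < Fintype.card (Prefs n N) := by exact_mod_cast Fintype.card_pos
  rw [expectedProposers_eq D D' h hj, div_le_iff₀ hcard]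
  calc _ ≤ ∑ _π : Prefs n N, (n : ℝ) := by
        refine Finset.sum_le_sum fun π _ => ?_
        have := norm_integral_le_of_norm_le_const (μ := signalLaw D D' π)
          (f := fun σ => (proposers (finalRejections L (sampleOf h π σ)) j : ℝ)) (C := n)
          (ae_of_all _ fun σ => by
            rw [Real.norm_natCast]; exact_mod_cast proposers_le _ _)
        simp only [probReal_univ, mul_one] at this
        exact (le_abs_self _).trans this
    _ = _ := by simp [mul_comm]

/-- The maximal error of the recursion for typical samples. -/
def recursionError (n K m : ℕ) : ℝ := n / m + 2 * K * (n / m + 1)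

lemma sampleLaw_unsolved_le [NeZero N] {m : ℕ} (hm : 0 < m) (hn : 0 < n) :
    (sampleLaw D D' n K N).real (unsolved D D' n K N L (recursionError n K m)) ≤
      4 * K ^ 2 * m ^ (K + 2) / n := by
  refine le_trans ?_ (sampleLaw_atypical_le D D' (N := N) (L := L) hm hn)
  refine ENNReal.toReal_mono (measure_ne_top _ _) ?_
  refine le_trans (measure_mono ?_)
    (sampleLaw_reorder_preimage_le D D' (L := L) (measurableSet_atypical D D' (N := N) m))
  intro X hX
  by_contra hX'
  exact hX (approxSolution_of_reorder D D' hm hX')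

lemma abs_expectedProposers_sub_solution_le [NeZero N] (h : K < N) {δ c p : ℝ} (hδ : 0 ≤ δ)
    (hc : 0 < c) (hc1 : c ≤ 1) (hcN : c ≤ (1 - 1 / (N : ℝ)) ^ (n * K))
    (hp : (sampleLaw D D' n K N).real (unsolved D D' n K N L δ) ≤ p) {a : ℕ → ℕ}
    (ha : ApproxSolution D D' n K N L δ a) (j : Fin K) :
    |expectedProposers D D' K L n N (j + 1) - a j| ≤
      ((N : ℝ) / (N - K)) ^ (n * K) * (4 * K * δ / c + n * p) := by
  have hNK : (0 : ℝ) < (N : ℝ) - K := by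
    rw [sub_pos]; exact_mod_cast h
  refine (abs_expectedProposers_sub_le D D' h j.2 (a j)).trans ?_
  refine mul_le_mul_of_nonneg_left ?_ (by positivity)
  have hU := measurableSet_unsolved D D' (n := n) (K := K) (N := N) (L := L) δ
  have hpt : ∀ X : Sample n K N, |(proposers (finalRejections L X) j : ℝ) - a j| ≤
      4 * K * δ / c + (unsolved D D' n K N L δ).indicator (fun _ => (n : ℝ)) X := by
    intro X
    by_cases hX : X ∈ unsolved D D' n K N L δ
    · rw [Set.indicator_of_mem hX]
      have h1 : (proposers (finalRejections L X) j : ℝ) ≤ n := by exact_mod_cast proposers_le _ _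
      have h2 : (a j : ℝ) ≤ n := by exact_mod_cast ha.le j
      have h3 : (0 : ℝ) ≤ proposers (finalRejections L X) j := Nat.cast_nonneg _
      have h4 : (0 : ℝ) ≤ a j := Nat.cast_nonneg _
      have h5 : 0 ≤ 4 * K * δ / c := by positivity
      rw [abs_le]; constructor <;> linarith
    · rw [Set.indicator_of_notMem hX, add_zero]
      exact (not_not.1 hX : ApproxSolution D D' n K N L δ _).abs_sub_le hδ hc hc1 hcN ha j
  have hI : Integrable ((unsolved D D' n K N L δ).indicator fun _ => (n : ℝ))
      (sampleLaw D D' n K N) := (integrable_const _).indicator hU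
  have hJ : Integrable (fun X : Sample n K N => |(proposers (finalRejections L X) j : ℝ) - a j|)
      (sampleLaw D D' n K N) :=
    integrable_of_abs_le (((measurable_proposers j).sub_const _).abs) (C := 4 * K * δ / c + n)
      fun X => by
        rw [abs_abs]
        refine (hpt X).trans (add_le_add_right ?_ _)
        exact Set.indicator_le_self' (fun _ _ => Nat.cast_nonneg _) X
  refine (integral_mono hJ ((integrable_const _).add hI) hpt).trans ?_
  simp only [Pi.add_apply]
  rw [integral_add (integrable_const _) hI, integral_indicator hU]
  simp only [integral_const, measureReal_restrict_apply_univ, probReal_univ, smul_eq_mul]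
  have : (sampleLaw D D' n K N).real (unsolved D D' n K N L δ) * n ≤ n * p := by
    rw [mul_comm]; gcongr
  linarith

/-- The recursion for a fixed number of students, with an explicit error. -/
lemma abs_recursion_le {M : ℝ} (h : K < numUniv M n) {m : ℕ} (hm : 0 < m) (hn : 0 < n)
    {c C : ℝ} (hc : 0 < c) (hc1 : c ≤ 1) (hcN : c ≤ (1 - 1 / (numUniv M n : ℝ)) ^ (n * K))
    (hC : ((numUniv M n : ℝ) / (numUniv M n - K)) ^ (n * K) ≤ C)
    (hp : 4 * (K : ℝ) ^ 2 * m ^ (K + 2) / n < 1) (j : ℕ) (hj : j + 1 < K) :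
    |y D D' M K L n (j + 2) - (y D D' M K L n (j + 1) -
      f D D' M K L n (j + 1) (y D D' M K L n))| ≤
      (recursionError n K m + (K + 2) * (C * (4 * K * recursionError n K m / c +
        n * (4 * (K : ℝ) ^ 2 * m ^ (K + 2) / n))) + K) / n := by
  set N := numUniv M n with hN
  set δ := recursionError n K m with hδ
  set p := 4 * (K : ℝ) ^ 2 * m ^ (K + 2) / n with hpdef
  have hNz : NeZero N := ⟨by omega⟩
  have hn' : (0 : ℝ) < n := by exact_mod_cast hn
  have hδ0 : 0 ≤ δ := by rw [hδ, recursionError]; positivity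
  have hp0 : 0 ≤ p := by rw [hpdef]; positivity
  have hU := sampleLaw_unsolved_le D D' (N := N) (K := K) (L := L) hm hn
  -- The solution set has positive probability, so it is nonempty. The counts of one such sample
  -- serve as the deterministic reference solution `a`.
  obtain ⟨X, hX⟩ : ∃ X, X ∉ unsolved D D' n K N L δ := by
    by_contra hall
    push Not at hall
    have : unsolved D D' n K N L δ = Set.univ := Set.eq_univ_of_forall hall
    rw [this, probReal_univ] at hU
    linarith
  obtain ⟨a, ha⟩ : ∃ a, ApproxSolution D D' n K N L δ a := ⟨_, not_not.1 hX⟩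
  set E := C * (4 * K * δ / c + n * p) with hE
  have hEj : ∀ k : Fin K, |expectedProposers D D' K L n N (k + 1) - a k| ≤ E := fun k =>
    (abs_expectedProposers_sub_solution_le D D' h hδ0 hc hc1 hcN hU ha k).trans
      (mul_le_mul_of_nonneg_right hC (by positivity))
  have hyn : ∀ k : ℕ, y D D' M K L n (k + 1) * n = expectedProposers D D' K L n N (k + 1) :=
    fun k => div_mul_cancel₀ _ hn'.ne'
  set b := proposalNum K n (y D D' M K L n) with hb
  have hbk : ∀ k : Fin K, b k = ⌊expectedProposers D D' K L n N (k + 1)⌋₊ := fun k => by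
    rw [hb, proposalNum, hyn]
  have hbn : ∀ k, b k ≤ n := fun k => by
    rw [hbk]
    exact Nat.floor_le_of_le (expectedProposers_le D D' h.le k.2)
  have hba : ∀ k : Fin K, |(b k : ℝ) - a k| ≤ E + 1 := fun k => by
    have h1 := Nat.floor_le (expectedProposers_nonneg D D' (n := n) (K := K) (N := N) (L := L)
      (k + 1))
    have h2 := Nat.lt_floor_add_one (expectedProposers D D' K L n N (k + 1))
    rw [← hbk] at h1 h2
    have h3 := hEj k
    rw [abs_le] at *
    constructor <;> linarith
  let j₀ : Fin K := ⟨j, by omega⟩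
  let j₁ : Fin K := ⟨j + 1, hj⟩
  have hf : f D D' M K L n (j + 1) (y D D' M K L n) * n = meanOf D D' n N L b j₀ := by
    rw [f, div_mul_cancel₀ _ hn'.ne']
    exact expectedAccepted_eq D D' hbn j₀
  have hlip := meanOf_lipschitz D D' (N := N) (L := L) (a := fun k : Fin K => a k) (b := b)
    (fun k => ha.le k) hbn j₀
  have hlip' : ∑ k : Fin K, |(b k : ℝ) - a k| ≤ K * (E + 1) := by
    refine (Finset.sum_le_sum fun k _ => hba k).trans (le_of_eq ?_)
    simp; ring
  have hsucc := ha.succ j₀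
  have e0 := hEj j₀
  have e1 := hEj j₁
  have habs : ∀ z : ℝ, |z| * n = |z * n| := fun z => by rw [abs_mul, Nat.abs_cast]
  rw [le_div_iff₀ hn', habs, sub_mul, sub_mul, hf, hyn (j + 1), hyn j]
  change |expectedProposers D D' K L n N (j + 1) - a j| ≤ E at e0
  change |expectedProposers D D' K L n N (j + 1 + 1) - a (j + 1)| ≤ E at e1
  change |(a (j + 1) : ℝ) - (a j - meanOf D D' n N L (fun k : Fin K => a k) j₀)| ≤ δ at hsucc
  -- The error consists of `δ` from the recursion for `a`, `2 * E` from the two expectations, and `K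
  -- * (E + 1)` from the Lipschitz bound, where the 1 comes from rounding down.
  have hl := hlip.trans hlip'
  rw [abs_le] at *
  constructor <;> linarith

end Recursion

/-! ### Asymptotics -/

section Asymptotics

lemma exp_neg_two_mul_le {x : ℝ} (hx0 : 0 ≤ x) (hx : x ≤ 1 / 2) :
    Real.exp (-(2 * x)) ≤ 1 - x := by
  rw [Real.exp_neg]
  have h1 := Real.add_one_le_exp (2 * x)
  refine (inv_anti₀ (by linarith) h1).trans ?_
  rw [inv_le_iff_one_le_mul₀ (by linarith)]
  nlinarith

/-- Uses 1 - x ≥ exp(-2x) at x = 1/N together with n/N ≤ 2/M. This bounds the stability constant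
away from 0. -/
lemma le_one_sub_inv_pow {M : ℝ} (hM : 0 < M) {n N K : ℕ} (hN : 2 ≤ N)
    (hNM : M * n / 2 ≤ N) : Real.exp (-(4 * K / M)) ≤ (1 - 1 / (N : ℝ)) ^ (n * K) := by
  have hN' : (2 : ℝ) ≤ N := by exact_mod_cast hN
  have h1 := exp_neg_two_mul_le (x := 1 / (N : ℝ)) (by positivity) (by gcongr)
  refine le_trans ?_ (pow_le_pow_left₀ (Real.exp_pos _).le h1 _)
  rw [← Real.exp_nat_mul, Real.exp_le_exp]
  have h2 : (n : ℝ) * (1 / N) ≤ 2 / M := by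
    rw [mul_one_div, div_le_div_iff₀ (by linarith) hM]; linarith
  push_cast
  calc -(4 * (K : ℝ) / M) = -(2 * K * (2 / M)) := by ring
    _ ≤ -(2 * K * (n * (1 / N))) := by gcongr
    _ = _ := by ring

lemma div_sub_pow_le {M : ℝ} (hM : 0 < M) {n N K : ℕ} (hN : 2 * K ≤ N) (hN0 : 0 < N)
    (hNM : M * n / 2 ≤ N) :
    ((N : ℝ) / (N - K)) ^ (n * K) ≤ Real.exp (4 * K ^ 2 / M) := by
  have hN0' : (0 : ℝ) < N := by exact_mod_cast hN0
  have hN' : (2 : ℝ) * K ≤ N := by exact_mod_cast hN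
  have hNK : (0 : ℝ) < N - K := by linarith
  have h1 : (N : ℝ) / (N - K) ≤ Real.exp (2 * K / N) := by
    refine le_trans ?_ (Real.add_one_le_exp _)
    rw [div_le_iff₀ hNK]
    have : (2 * K / N + 1 : ℝ) * (N - K) = N + K * (1 - 2 * K / N) := by field_simp; ring
    rw [this]
    have h2 : 2 * (K : ℝ) / N ≤ 1 := by rw [div_le_one hN0']; exact hN'
    have : 0 ≤ (K : ℝ) * (1 - 2 * K / N) := mul_nonneg (Nat.cast_nonneg _) (by linarith)
    linarith
  refine (pow_le_pow_left₀ (by positivity) h1 _).trans ?_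
  rw [← Real.exp_nat_mul, Real.exp_le_exp]
  have h2 : (n : ℝ) / N ≤ 2 / M := by
    rw [div_le_div_iff₀ hN0' hM]; linarith
  push_cast
  calc (n : ℝ) * K * (2 * K / N) = 2 * K ^ 2 * (n / N) := by ring
    _ ≤ 2 * K ^ 2 * (2 / M) := by gcongr
    _ = _ := by ring

lemma tendsto_numUniv {M : ℝ} (hM : 0 < M) : Tendsto (numUniv M) atTop atTop :=
  tendsto_nat_floor_atTop.comp (tendsto_natCast_atTop_atTop.const_mul_atTop hM)

lemma eventually_le_numUniv {M : ℝ} (hM : 0 < M) : ∀ᶠ n : ℕ in atTop, M * n / 2 ≤ numUniv M n := by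
  filter_upwards [(tendsto_natCast_atTop_atTop.const_mul_atTop hM).eventually_ge_atTop
    (2 : ℝ)] with n hn
  have := Nat.lt_floor_add_one (M * n)
  unfold numUniv
  linarith

lemma tendsto_recursionBound (K m : ℕ) (c C : ℝ) :
    Tendsto (fun n : ℕ => (recursionError n K m + (K + 2) * (C * (4 * K * recursionError n K m / c +
        n * (4 * (K : ℝ) ^ 2 * m ^ (K + 2) / n))) + K) / n) atTop
      (𝓝 ((1 + 2 * K) * (1 + (K + 2) * (C * (4 * K / c))) * (1 / m))) := by
  have h0 : Tendsto (fun n : ℕ => (1 : ℝ) / n) atTop (𝓝 0) :=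
    tendsto_const_nhds.div_atTop tendsto_natCast_atTop_atTop
  have h1 : Tendsto (fun n : ℕ => ((1 + 2 * K) * (1 / m) + 2 * K * (1 / n) : ℝ)) atTop
      (𝓝 ((1 + 2 * K) * (1 / m) + 2 * K * 0)) := tendsto_const_nhds.add (h0.const_mul _)
  have h2 := (h1.mul_const (1 + (K + 2) * (C * (4 * K / c)))).add
    (h0.const_mul ((K + 2) * (C * (4 * (K : ℝ) ^ 2 * m ^ (K + 2))) + K))
  have e : ((1 + 2 * (K : ℝ)) * (1 / m) + 2 * K * 0) * (1 + (K + 2) * (C * (4 * K / c))) +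
      ((K + 2) * (C * (4 * (K : ℝ) ^ 2 * m ^ (K + 2))) + K) * 0 =
      (1 + 2 * K) * (1 + (K + 2) * (C * (4 * K / c))) * (1 / m) := by ring
  rw [e] at h2
  refine h2.congr' ?_
  filter_upwards [eventually_gt_atTop 0] with n hn
  have hn' : (n : ℝ) ≠ 0 := by exact_mod_cast hn.ne'
  rw [mul_div_cancel₀ _ hn', eq_div_iff hn']
  have key : ((1 + 2 * K) * (1 / m) + 2 * K * (1 / n) : ℝ) * n = recursionError n K m := by
    unfold recursionError
    have : (1 : ℝ) / n * n = 1 := by field_simp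
    linear_combination (2 * (K : ℝ)) * this
  have key2 : (1 : ℝ) / n * n = 1 := by field_simp
  linear_combination (1 + (K + 2) * (C * (4 * K / c))) * key +
    ((K + 2) * (C * (4 * (K : ℝ) ^ 2 * m ^ (K + 2))) + K) * key2

/-- The limits are taken in order. First `m` is fixed so that the limiting error, a constant times
`1 / m`, is below `ε`; then `n` grows, which removes the failure probability and rounding terms. -/
lemma tendsto_recursion (D D' : Measure ℝ) [IsProbabilityMeasure D] [IsProbabilityMeasure D']
    {M : ℝ} (hM : 0 < M) (K L j : ℕ) (hj : j + 1 < K) :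
    Tendsto (fun n : ℕ => y D D' M K L n (j + 2) - (y D D' M K L n (j + 1) -
      f D D' M K L n (j + 1) (y D D' M K L n))) atTop (𝓝 0) := by
  set c := Real.exp (-(4 * K / M)) with hc
  set C := Real.exp (4 * K ^ 2 / M) with hC
  have hc1 : c ≤ 1 := by
    rw [hc, Real.exp_le_one_iff]
    have : 0 ≤ 4 * (K : ℝ) / M := by positivity
    linarith
  rw [Metric.tendsto_nhds]
  intro ε hε
  obtain ⟨m, hm0, hm⟩ : ∃ m : ℕ, 0 < m ∧
      (1 + 2 * K) * (1 + (K + 2) * (C * (4 * K / c))) * (1 / (m : ℝ)) < ε := by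
    have h0 : Tendsto (fun m : ℕ => (1 + 2 * K) * (1 + (K + 2) * (C * (4 * K / c))) *
        (1 / (m : ℝ))) atTop (𝓝 ((1 + 2 * K) * (1 + (K + 2) * (C * (4 * K / c))) * 0)) :=
      (tendsto_const_nhds.div_atTop tendsto_natCast_atTop_atTop).const_mul _
    rw [mul_zero] at h0
    exact ((eventually_gt_atTop 0).and (h0.eventually_lt_const hε)).exists
  have hp : Tendsto (fun n : ℕ => 4 * (K : ℝ) ^ 2 * m ^ (K + 2) / n) atTop (𝓝 0) :=
    tendsto_const_nhds.div_atTop tendsto_natCast_atTop_atTop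
  filter_upwards [(tendsto_recursionBound K m c C).eventually_lt_const hm,
    hp.eventually_lt_const one_pos, eventually_gt_atTop 0, eventually_le_numUniv hM,
    (tendsto_numUniv hM).eventually_ge_atTop (2 * K + 2)] with n h1 h2 h3 h4 h5
  rw [Real.dist_eq, sub_zero]
  refine (abs_recursion_le D D' (by omega) hm0 h3 (Real.exp_pos _) hc1
    (le_one_sub_inv_pow hM (by omega) h4)
    (div_sub_pow_le hM (by omega) (by omega) h4) h2 j hj).trans_lt h1

lemma y_one_eventually (D D' : Measure ℝ) [IsProbabilityMeasure D] [IsProbabilityMeasure D']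
    {M : ℝ} (hM : 0 < M) {K : ℕ} (L : ℕ) (hK : 0 < K) :
    ∀ᶠ n in atTop, y D D' M K L n 1 = 1 := by
  filter_upwards [(tendsto_numUniv hM).eventually_gt_atTop K, eventually_gt_atTop 0] with n h1 h2
  have : NeZero (numUniv M n) := ⟨by omega⟩
  have hn : (n : ℝ) ≠ 0 := by exact_mod_cast h2.ne'
  change expectedProposers D D' K L n (numUniv M n) 1 / n = 1
  rw [expectedProposers_one D D' h1 hK, div_self hn]

lemma f_type_zero (D D' : Measure ℝ) (M : ℝ) (K L n : ℕ) (x : ℕ → ℝ) :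
    f D D' M K L n 0 x = 0 := by
  simp [f, expectedAccepted, acceptedCount, Proposal.type]

end Asymptotics

end SignalMatching

end

theorem theorem3 (D D' : Measure ℝ) [IsProbabilityMeasure D] [IsProbabilityMeasure D']
    (M : ℝ) (hM : 0 < M) (K L : ℕ) (i : ℕ) (hi : i ∈ Finset.Icc 1 K) :
    Tendsto
      (fun n : ℕ =>
        SignalMatching.y D D' M K L n i -
          (SignalMatching.y D D' M K L n (i - 1) -
            SignalMatching.f D D' M K L n (i - 1) (SignalMatching.y D D' M K L n)))
      atTop (𝓝 0) := by
  obtain ⟨hi1, hiK⟩ := Finset.mem_Icc.1 hi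
  rcases i with _ | _ | j
  · omega
  -- Every student makes her first proposal once there are more than `K` universities, so for `i =
  -- 1` the difference is eventually exactly 0.
  · refine tendsto_const_nhds.congr' ?_
    filter_upwards [SignalMatching.y_one_eventually D D' hM L (by omega : 0 < K)] with n hn
    simp only [zero_add, Nat.sub_self]
    rw [hn, SignalMatching.f_type_zero]
    simp [SignalMatching.y]
  · exact SignalMatching.tendsto_recursion D D' hM K L j (by omega)
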